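/- Let $\widehat G$ be a finite group, $G\le\widehat G$ a subgroup of index $2$, and $x\in\widehat G\setminus G$. Real representations. A \emph{Real representation} of $G$ is a complex vector space $V$ with an action of $\widehat G$ by real-linear maps in which elements of $G$ act $\mathbb C$-linearly and elements of $\widehat G\setminus G$ act antilinearly; equivalently, $V$ is a module over the twisted group algebra $\mathbb C*\widehat G$, with $\alpha g * \beta h=\alpha\beta\,gh$ for $g\in G$ and $\alpha g*\beta h=\alpha\overline{\beta}\,gh$ for $g\notin G$. Types of characters. Let $\chi$ be an irreducible complex character of $G$, afforded by a simple $\mathbb CG$-module $S$. Let $W$ be the simple $\mathbb RG$-module contained in $S|_{\mathbb RG}$ and let $V$ be the simple $\mathbb C*\widehat G$-module whose restriction to $\mathbb CG$ contains $S$ (each unique up to isomorphism). Put $\mathbb F_d=\mathrm{End}_{\mathbb C*\widehat G}(V)$ and $\mathbb F_a=\mathrm{End}_{\mathbb RG}(W)$; each is isomorphic to $\mathbb R$, $\mathbb C$ or $\mathbb H$ as a real algebra. The type of $\chi$ is determined by the pair $(\mathbb F_d,\mathbb F_a)$ as follows: I: $(\mathbb R,\mathbb R)$; II: $(\mathbb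 H,\mathbb R)$; III: $(\mathbb C,\mathbb R)$; V: $(\mathbb R,\mathbb C)$; VI: $(\mathbb H,\mathbb C)$; VIII: $(\mathbb H,\mathbb H)$; IX: $(\mathbb R,\mathbb H)$; X: $(\mathbb C,\mathbb H)$; and in the case $(\mathbb C,\mathbb C)$ the type is IV if $V|_{\mathbb RG}$ is isotypic and VII if it is not. Let $N_I,\dots,N_X$ be the numbers of irreducible complex characters of $G$ of each type. Types of classes. The Klein four-group $\{1,a,b,c\}$ acts on the conjugacy classes $K$ of $G$ by $K^a=K^{-1}$, $K^b=xKx^{-1}$, $K^c=xK^{-1}x^{-1}$. A class has type $n\in\{1,4\}$ if its orbit has $n$ elements, and type $2g$, $g\in\{a,b,c\}$, if its orbit has two elements and $K^g=K$. Let $C_1,C_{2a},C_{2b},C_{2c},C_4$ be the numbers of classes of each type. Then the following three equations hold: $$N_I+N_{II}+N_{III}+N_{VIII}+N_{IX}+N_X=C_1+C_{2a},$$ $$N_{IV}+N_V+N_{VI}+N_{VII}=C_{2b}+C_{2c}+C_4,$$ $$N_{III}+N_{IV}+N_{VII}+N_X=C_{2a}+C_{2b}+C_4.$$ Moreover, these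 equations are linearly independent over $\mathbb Q$, both as linear equations in the fifteen variables $N_?$, $C_?$ and already through their left-hand sides as linear forms in the ten variables $N_?$. -/

import Mathlib

open scoped Quaternion MonoidAlgebra ComplexConjugate

universe u

/-! ### Representations over the complex numbers and over the reals -/

/-- A complex representation of `K`, regarded as a representation over the reals. -/
def Representation.toReal {K S : Type*} [Group K] [AddCommGroup S] [Module ℂ S]
    (ρ : Representation ℂ K S) : Representation ℝ K S where
  toFun g := (ρ g).restrictScalars ℝ
  map_one' := by ext; simp
  map_mul' g h := by ext; simp

/-- A *Real* representation of `G`, where `G` is a subgroup of index two of `Ghat`: a complex vector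
space `V` on which `Ghat` acts, with `G` acting linearly and `Ghat \ G` acting antilinearly.
These are the modules over the twisted group algebra `ℂ * Ghat`, in which
`(α g) * (β h) = α β g h` for `g ∈ G` and `(α g) * (β h) = α (conj β) g h` for `g ∉ G`. -/
structure RealRepresentation {Ghat : Type*} [Group Ghat] (G : Subgroup Ghat)
    (V : Type*) [AddCommGroup V] [Module ℂ V] where
  /-- the underlying action by real-linear maps -/
  act : Representation ℝ Ghat V
  act_smul_of_mem : ∀ g ∈ G, ∀ (c : ℂ) (v : V), act g (c • v) = c • act g v
  act_smul_of_notMem : ∀ g ∉ G, ∀ (c : ℂ) (v : V), act g (c • v) = conj c • act g v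

namespace RealRepresentation

variable {Ghat : Type*} [Group Ghat] {G : Subgroup Ghat} {V : Type*} [AddCommGroup V] [Module ℂ V]

/-- Restriction to a complex representation of `G`. -/
def restrictComplex (κ : RealRepresentation G V) : Representation ℂ G V where
  toFun g :=
    { toFun := fun v => κ.act g v
      map_add' := fun v w => map_add _ v w
      map_smul' := fun c v => κ.act_smul_of_mem g g.2 c v }
  map_one' := by ext; simp
  map_mul' g h := by ext; simp

/-- Restriction to a real representation of `G`. -/
def restrictReal (κ : RealRepresentation G V) : Representation ℝ G V :=
  κ.act.comp G.subtype

/-- `V` is a simple `ℂ * Ghat`-module. -/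
def IsSimple (κ : RealRepresentation G V) : Prop :=
  Nontrivial V ∧
    ∀ U : Submodule ℂ V, (∀ (g : Ghat), ∀ v ∈ U, κ.act g v ∈ U) → U = ⊥ ∨ U = ⊤

/-- The real algebra of `ℂ * Ghat`-module endomorphisms of `V`. -/
def endAlgebra (κ : RealRepresentation G V) : Subalgebra ℝ (Module.End ℝ V) where
  carrier := {f | (∀ (c : ℂ) (v : V), f (c • v) = c • f v) ∧
    ∀ (g : Ghat) (v : V), f (κ.act g v) = κ.act g (f v)}
  mul_mem' := by
    rintro f g ⟨hf, hf'⟩ ⟨hg, hg'⟩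
    exact ⟨fun c v => by simp [hf, hg], fun x v => by simp [hf', hg']⟩
  add_mem' := by
    rintro f g ⟨hf, hf'⟩ ⟨hg, hg'⟩
    exact ⟨fun c v => by simp [hf, hg], fun x v => by simp [hf', hg']⟩
  algebraMap_mem' r :=
    ⟨fun c v => by simp [Module.algebraMap_end_apply, smul_comm r c v],
      fun x v => by simp [Module.algebraMap_end_apply]⟩

end RealRepresentation

/-! ### The ten types of irreducible characters -/

/-- The three finite-dimensional real division algebras: `ℝ`, `ℂ` and the quaternions. -/
inductive RealDivisionType
  | R | C | Q

/-- The real algebra `E` is isomorphic to `ℝ`, `ℂ`, or `ℍ`, respectively. -/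
def RealDivisionType.Holds (E : Type*) [Semiring E] [Algebra ℝ E] : RealDivisionType → Prop
  | .R => Nonempty (E ≃ₐ[ℝ] ℝ)
  | .C => Nonempty (E ≃ₐ[ℝ] ℂ)
  | .Q => Nonempty (E ≃ₐ[ℝ] ℍ[ℝ])

/-- The ten types of Dyson's tenfold way. -/
inductive DysonType
  | I | II | III | IV | V | VI | VII | VIII | IX | X

namespace DysonType

/-- The first letter of the Dyson label: the endomorphism algebra of the simple
`ℂ * Ghat`-module. -/
def Fd : DysonType → RealDivisionType
  | I => .R
  | II => .Q
  | III => .C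
  | IV => .C
  | V => .R
  | VI => .Q
  | VII => .C
  | VIII => .Q
  | IX => .R
  | X => .C

/-- The second letter of the Dyson label: the endomorphism algebra of the simple `ℝ G`-module. -/
def Fa : DysonType → RealDivisionType
  | I => .R
  | II => .R
  | III => .R
  | IV => .C
  | V => .C
  | VI => .C
  | VII => .C
  | VIII => .Q
  | IX => .Q
  | X => .Q

/-- The digit of the Dyson label, which separates `CC1` (type `VII`) from `CC2` (type `IV`):
the simple `ℂ * Ghat`-module, restricted to `ℝ G`, has two isomorphism classes of simple
submodules for `CC1`, and one (with multiplicity two) for `CC2`. -/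
def DigitHolds {Ghat : Type*} [Group Ghat] {G : Subgroup Ghat} {V : Type*} [AddCommGroup V]
    [Module ℂ V] (κ : RealRepresentation G V) : DysonType → Prop
  | IV => IsIsotypic ℝ[G] κ.restrictReal.asModule
  | VII => ¬ IsIsotypic ℝ[G] κ.restrictReal.asModule
  | _ => True

end DysonType

/-- The function `χ` is an irreducible complex character of `G`, afforded by a simple
`ℂ G`-module `S`, and it has type `t`. Here `V` is the simple `ℂ * Ghat`-module corresponding to `χ`
(its restriction to `ℂ G` contains `S`) and `W` is the simple `ℝ G`-module corresponding to `χ`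
(it is contained in the restriction of `S` to `ℝ G`). -/
def HasDysonType {Ghat : Type u} [Group Ghat] (G : Subgroup Ghat) (χ : G → ℂ) (t : DysonType) :
    Prop :=
  ∃ (S : Type u) (_ : AddCommGroup S) (_ : Module ℂ S) (_ : FiniteDimensional ℂ S)
    (ρ : Representation ℂ G S)
    (V : Type u) (_ : AddCommGroup V) (_ : Module ℂ V) (κ : RealRepresentation G V)
    (W : Type u) (_ : AddCommGroup W) (_ : Module ℝ W) (σ : Representation ℝ G W),
    ρ.IsIrreducible ∧ ρ.character = χ ∧
    κ.IsSimple ∧ (∃ f : Representation.IntertwiningMap ρ κ.restrictComplex, f ≠ 0) ∧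
    σ.IsIrreducible ∧ (∃ f : Representation.IntertwiningMap σ ρ.toReal, f ≠ 0) ∧
    t.Fd.Holds κ.endAlgebra ∧
    t.Fa.Holds (Representation.IntertwiningMap σ σ) ∧
    t.DigitHolds κ

/-- The number of irreducible complex characters of `G` of type `t`. -/
noncomputable def dysonCount {Ghat : Type u} [Group Ghat] (G : Subgroup Ghat) (t : DysonType) : ℕ :=
  {χ : G → ℂ | HasDysonType G χ t}.ncard

/-! ### The action of the Klein four-group on conjugacy classes -/

/-- The elements of the Klein four-group. -/
inductive KleinFour
  | one | a | b | c

/-- The class `K⁻¹`. -/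
def ConjClasses.invClass {K : Type*} [Group K] : ConjClasses K → ConjClasses K :=
  Quotient.map' (fun g => g⁻¹) (fun g h (hgh : IsConj g h) => by
    obtain ⟨c, hc⟩ := isConj_iff.1 hgh
    exact isConj_iff.2 ⟨c, by rw [← hc]; group⟩)

/-- Conjugation `g ↦ x g x⁻¹` on a subgroup `G` of index two. -/
noncomputable def conjOnIndexTwo {Ghat : Type*} [Group Ghat] {G : Subgroup Ghat}
    (hG : G.index = 2) (x : Ghat) : G ≃* G :=
  haveI := Subgroup.normal_of_index_eq_two hG
  MulAut.conjNormal x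

/-- The action on conjugacy classes of `G`: `K^a = K⁻¹`, `K^b = x K x⁻¹`, `K^c = x K⁻¹ x⁻¹`. -/
noncomputable def classAction {Ghat : Type*} [Group Ghat] {G : Subgroup Ghat} (hG : G.index = 2)
    (x : Ghat) : KleinFour → ConjClasses G → ConjClasses G
  | .one, K => K
  | .a, K => K.invClass
  | .b, K => K.map (conjOnIndexTwo hG x).toMonoidHom
  | .c, K => K.invClass.map (conjOnIndexTwo hG x).toMonoidHom

/-- The orbit of a conjugacy class. -/
def classOrbit {Ghat : Type*} [Group Ghat] {G : Subgroup Ghat} (hG : G.index = 2)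
    (x : Ghat) (K : ConjClasses G) : Set (ConjClasses G) :=
  Set.range fun k => classAction hG x k K

/-- The five types `1`, `2a`, `2b`, `2c`, `4` of conjugacy classes. -/
inductive ClassType
  | one | twoA | twoB | twoC | four

/-- The class `K` has the given type: the type records the size of the orbit, and the nontrivial
element that fixes `K` if this size is two. -/
def HasClassType {Ghat : Type*} [Group Ghat] {G : Subgroup Ghat} (hG : G.index = 2) (x : Ghat)
    (K : ConjClasses G) : ClassType → Prop
  | .one => (classOrbit hG x K).ncard = 1
  | .twoA => (classOrbit hG x K).ncard = 2 ∧ classAction hG x .a K = K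
  | .twoB => (classOrbit hG x K).ncard = 2 ∧ classAction hG x .b K = K
  | .twoC => (classOrbit hG x K).ncard = 2 ∧ classAction hG x .c K = K
  | .four => (classOrbit hG x K).ncard = 4

/-- The number of conjugacy classes of `G` of type `s`. -/
noncomputable def classCount {Ghat : Type*} [Group Ghat] {G : Subgroup Ghat} (hG : G.index = 2)
    (x : Ghat) (s : ClassType) : ℕ :=
  {K : ConjClasses G | HasClassType hG x K s}.ncard

/-! ### The theorem of Frobenius on real division algebras -/

section Frobenius

/-! Every equation says that the number of irreducible characters fixed, or not fixed, by an
involution equals the same number for conjugacy classes. The types with `Fa ≠ C` make up the first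
left-hand side, those with `Fa = C` the second and those with `Fd = C` the third; the right-hand
sides count the classes fixed by `a`, not fixed by `a`, and not fixed by `c`. The link is a
dichotomy for an automorphism `τ` of `G`, either the identity (for `Fa`) or conjugation by `x` (for
`Fd`). The relevant endomorphism algebra fails to be `ℂ` exactly when `S` has a nonzero antilinear
map `θ` with `θ ρ(g) = ρ(τ g) θ`. If there is none, Schur's lemma leaves only complex scalars. If
there is one, it yields an endomorphism that does not commute with a square root of `-1`. By
`exists_isTwisted_iff`, such a `θ` exists exactly when `χ((τ g)⁻¹) = χ(g)` for all `g`. Brauer's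
permutation lemma, a comparison of traces in two bases of the class functions, turns fixed
characters into fixed classes. Frobenius's theorem on real division algebras serves to give every
character a type; uniqueness of `V` and `W` up to isomorphism makes the type unique. The difference
between `ℝ` and `ℍ`, or between IV and VII, never affects the three sums. -/

theorem exists_sq_eq_neg_one_of_sq_eq_neg {D : Type*} [Ring D] [Algebra ℝ D] {y : D} {c : ℝ} (hc : c < 0)
    (h : y ^ 2 = algebraMap ℝ D c) :
    ∃ r : ℝ, r ≠ 0 ∧ (r • y) * (r • y) = -1 := by
  have h0 : 0 < Real.sqrt (-c) := Real.sqrt_pos.2 (by linarith)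
  refine ⟨(Real.sqrt (-c))⁻¹, inv_ne_zero h0.ne', ?_⟩
  rw [smul_mul_smul_comm, ← sq y, h, Algebra.algebraMap_eq_smul_one, smul_smul, ← mul_inv,
    Real.mul_self_sqrt (by linarith)]
  have : (-c)⁻¹ * c = -1 := by rw [inv_neg, neg_mul, inv_mul_cancel₀ hc.ne]
  rw [this]; simp

variable {D : Type*} [Ring D] [Algebra ℝ D] [IsDomain D]

/-- An irreducible real polynomial has degree at most two, so completing the square in the minimal
polynomial of `y` suffices. -/
theorem exists_sub_algebraMap_sq_eq [FiniteDimensional ℝ D] (y : D) :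
    ∃ a c : ℝ, (y - algebraMap ℝ D a) ^ 2 = algebraMap ℝ D c := by
  have hy : IsIntegral ℝ y := Algebra.IsIntegral.isIntegral y
  have hirr := minpoly.irreducible hy
  have hmon := minpoly.monic hy
  obtain ⟨a, b, c, h⟩ : ∃ a b c : ℝ, minpoly ℝ y = Polynomial.C a * Polynomial.X ^ 2
      + Polynomial.C b * Polynomial.X + Polynomial.C c :=
    ⟨_, _, _, Polynomial.eq_quadratic_of_degree_le_two hirr.degree_le_two⟩
  have h0 : algebraMap ℝ D a * y ^ 2 + algebraMap ℝ D b * y + algebraMap ℝ D c = 0 := by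
    have := minpoly.aeval ℝ y
    rw [h] at this
    simpa using this
  simp only [Algebra.algebraMap_eq_smul_one, smul_mul_assoc, one_mul] at h0 ⊢
  by_cases ha : a = 0
  · subst ha
    by_cases hb : b = 0
    · subst hb
      exfalso
      simp only [map_zero, zero_mul, zero_add] at h
      exact hirr.not_isUnit (h ▸ Polynomial.isUnit_C.2 (isUnit_iff_ne_zero.2 (by
        rintro rfl
        exact hmon.ne_zero (by simpa using h))))
    · refine ⟨-c / b, 0, ?_⟩
      have : y = (-c / b) • (1 : D) := by
        have h1 : b • y = b • ((-c / b) • (1 : D)) := by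
          rw [smul_smul, mul_div_cancel₀ _ hb, neg_smul]
          exact eq_neg_of_add_eq_zero_left (by simpa using h0)
        exact smul_right_injective _ hb h1
      rw [← this]; simp
  · refine ⟨-b / (2 * a), (b ^ 2 - 4 * a * c) / (4 * a ^ 2), ?_⟩
    have h2 : y ^ 2 = (-b / a) • y + (-c / a) • (1 : D) := by
      have h1 : a • y ^ 2 = a • ((-b / a) • y + (-c / a) • (1 : D)) := by
        rw [smul_add, smul_smul, smul_smul, mul_div_cancel₀ _ ha, mul_div_cancel₀ _ ha, neg_smul,
          neg_smul, ← neg_add]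
        exact eq_neg_of_add_eq_zero_left (by rw [← h0]; abel)
      exact smul_right_injective _ ha h1
    rw [sq, sub_mul, mul_sub, mul_sub, ← sq, h2]
    simp only [smul_mul_assoc, mul_smul_comm, one_mul, mul_one, smul_smul]
    match_scalars <;> field_simp <;> ring

theorem exists_eq_algebraMap_of_sq_eq_nonneg {y : D} {c : ℝ} (hc : 0 ≤ c)
    (h : y ^ 2 = algebraMap ℝ D c) : ∃ r : ℝ, y = algebraMap ℝ D r := by
  have hcomm : Commute y (algebraMap ℝ D (Real.sqrt c)) := (Algebra.commutes _ _).symm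
  have : y ^ 2 = (algebraMap ℝ D (Real.sqrt c)) ^ 2 := by
    rw [h, ← map_pow, Real.sq_sqrt hc]
  rcases hcomm.sq_eq_sq_iff_eq_or_eq_neg.1 this with h | h
  · exact ⟨_, h⟩
  · exact ⟨-Real.sqrt c, by rw [h, map_neg]⟩

/-- In a domain, commuting elements with equal squares agree up to sign. This is applied to `y - a`
and `√(-c) i`, whose squares are both `c < 0`. -/
theorem exists_eq_algebraMap_add_smul_of_commute [FiniteDimensional ℝ D] {i : D} (hi : i * i = -1)
    {y : D} (hy : Commute y i) : ∃ a b : ℝ, y = algebraMap ℝ D a + b • i := by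
  obtain ⟨a, c, h⟩ := exists_sub_algebraMap_sq_eq y
  rcases le_or_gt 0 c with hc | hc
  · obtain ⟨r, hr⟩ := exists_eq_algebraMap_of_sq_eq_nonneg hc h
    exact ⟨a + r, 0, by rw [map_add, ← hr]; simp⟩
  · have h1 : Commute (y - algebraMap ℝ D a) (Real.sqrt (-c) • i) :=
      (hy.sub_left (Algebra.commutes _ _)).smul_right _
    have : (y - algebraMap ℝ D a) ^ 2 = (Real.sqrt (-c) • i) ^ 2 := by
      rw [h, sq, smul_mul_smul_comm, hi, Real.mul_self_sqrt (by linarith),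
        Algebra.algebraMap_eq_smul_one]
      simp
    rcases h1.sq_eq_sq_iff_eq_or_eq_neg.1 this with h | h
    · exact ⟨a, Real.sqrt (-c), by rw [← h]; abel⟩
    · exact ⟨a, -Real.sqrt (-c), by rw [neg_smul, ← h]; abel⟩

/-- If `D ≠ ℝ`, completing the square produces `i` with `i² = -1`. Then `D` splits into elements
commuting with `i`, which form `ℝ + ℝ i`, and elements anticommuting with `i`. A nonzero element of
the second part rescales to `j` with `j² = -1`, and right multiplication by `j` carries the second
part into the first, so `1, i, j, ij` span `D`. -/
theorem exists_realDivisionType_holds [FiniteDimensional ℝ D] :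
    ∃ t : RealDivisionType, t.Holds D := by
  by_cases hR : ∀ y : D, ∃ r : ℝ, y = algebraMap ℝ D r
  · exact ⟨.R, ⟨(AlgEquiv.ofBijective (Algebra.ofId ℝ D)
      ⟨(algebraMap ℝ D).injective, fun y => (hR y).imp fun r h => h.symm⟩).symm⟩⟩
  push Not at hR
  obtain ⟨i, hi⟩ : ∃ i : D, i * i = -1 := by
    obtain ⟨y, hy⟩ := hR
    obtain ⟨a, c, h⟩ := exists_sub_algebraMap_sq_eq y
    rcases le_or_gt 0 c with hc | hc
    · obtain ⟨r, hr⟩ := exists_eq_algebraMap_of_sq_eq_nonneg hc h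
      exact absurd (by rw [map_add, ← hr]; abel) (hy (r + a))
    · obtain ⟨r, -, hr⟩ := exists_sq_eq_neg_one_of_sq_eq_neg hc h
      exact ⟨_, hr⟩
  by_cases hC : ∀ y : D, Commute y i
  · refine ⟨.C, ⟨(AlgEquiv.ofBijective (Complex.liftAux i hi)
      ⟨(Complex.liftAux i hi : ℂ →+* D).injective, fun y => ?_⟩).symm⟩⟩
    obtain ⟨a, b, h⟩ := exists_eq_algebraMap_add_smul_of_commute hi (hC y)
    exact ⟨⟨a, b⟩, by simp [Complex.liftAux_apply, h]⟩
  push Not at hC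
  -- `y + i y i` is twice the anticommuting component of `y`, and `y - i y i` twice the commuting
  -- one.
  have hanti : ∀ y : D, (y + i * y * i) * i = - (i * (y + i * y * i)) := by
    intro y
    have h1 : i * y * i * i = -(i * y) := by rw [mul_assoc, hi]; simp
    have h2 : i * (i * y * i) = - (y * i) := by rw [← mul_assoc, ← mul_assoc, hi]; simp
    rw [add_mul, mul_add, h1, h2]; abel
  obtain ⟨j, hj, hij⟩ : ∃ j : D, j * j = -1 ∧ j * i = -(i * j) := by
    obtain ⟨y, hy⟩ := hC
    obtain ⟨z, hz⟩ : ∃ z, z = y + i * y * i := ⟨_, rfl⟩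
    have hzi : z * i = -(i * z) := hz ▸ hanti y
    have hz0 : z ≠ 0 := by
      intro h0
      apply hy
      have h1 : y = -(i * y * i) := eq_neg_of_add_eq_zero_left (hz ▸ h0)
      have h2 : y * i = -(i * y * i) * i := by rw [← h1]
      rw [neg_mul, mul_assoc, hi] at h2
      exact h2.trans (by simp)
    have hzz : Commute (z * z) i := by
      show z * z * i = i * (z * z)
      rw [mul_assoc, hzi, mul_neg, ← mul_assoc, hzi]; simp [mul_assoc]
    obtain ⟨a, b, hab⟩ := exists_eq_algebraMap_add_smul_of_commute hi hzz
    -- `z` commutes with `z² = a + b i` but anticommutes with `i`, so `b = 0`. Then `a ≥ 0` would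
    -- make `z` a real scalar, which commutes with `i`; hence `a < 0` and `z` can be rescaled.
    have hb : b • (i * z) = 0 := by
      have h1 : z * (z * z) = (z * z) * z := by rw [mul_assoc]
      rw [hab, mul_add, add_mul, ← Algebra.commutes, mul_smul_comm, smul_mul_assoc, hzi] at h1
      have h2 := add_left_cancel h1
      rw [smul_neg, neg_eq_iff_add_eq_zero, ← two_smul ℝ] at h2
      exact (smul_eq_zero.1 h2).resolve_left two_ne_zero
    have hi0 : i ≠ 0 := by rintro rfl; simp at hi
    have hb0 : b = 0 := (smul_eq_zero.1 hb).resolve_right (mul_ne_zero hi0 hz0)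
    rw [hb0, zero_smul, add_zero, ← sq] at hab
    rcases le_or_gt 0 a with ha | ha
    · obtain ⟨r, hr⟩ := exists_eq_algebraMap_of_sq_eq_nonneg ha hab
      rw [hr, Algebra.commutes, eq_neg_iff_add_eq_zero, ← two_smul ℝ, ← Algebra.commutes,
        ← hr] at hzi
      exact absurd ((smul_eq_zero.1 hzi).resolve_left two_ne_zero) (mul_ne_zero hz0 hi0)
    · obtain ⟨r, -, hr⟩ := exists_sq_eq_neg_one_of_sq_eq_neg ha hab
      exact ⟨r • z, hr, by rw [smul_mul_assoc, hzi, mul_smul_comm, smul_neg]⟩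
  let q : QuaternionAlgebra.Basis D (-1 : ℝ) (0 : ℝ) (-1 : ℝ) :=
    { i := i, j := j, k := i * j
      i_mul_i := by rw [hi]; simp
      j_mul_j := by rw [hj]; simp
      i_mul_j := rfl
      j_mul_i := by rw [hij]; simp }
  let φ : ℍ[ℝ] →ₐ[ℝ] D := q.liftHom
  refine ⟨.Q, ⟨(AlgEquiv.ofBijective φ ⟨(φ : ℍ[ℝ] →+* D).injective, fun y => ?_⟩).symm⟩⟩
  have hp : Commute (y - i * y * i) i := by
    have h1 : i * y * i * i = -(i * y) := by rw [mul_assoc, hi]; simp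
    have h2 : i * (i * y * i) = - (y * i) := by rw [← mul_assoc, ← mul_assoc, hi]; simp
    show (y - i * y * i) * i = i * (y - i * y * i)
    rw [sub_mul, mul_sub, h1, h2]; abel
  have hm : Commute ((y + i * y * i) * j) i := by
    show (y + i * y * i) * j * i = i * ((y + i * y * i) * j)
    rw [mul_assoc, hij, mul_neg, ← mul_assoc, hanti]
    simp [mul_assoc]
  obtain ⟨a, b, h1⟩ := exists_eq_algebraMap_add_smul_of_commute hi hp
  obtain ⟨c, d, h2⟩ := exists_eq_algebraMap_add_smul_of_commute hi hm
  have h3 : y + i * y * i = -(c • j + d • (i * j)) := by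
    have : (y + i * y * i) * j * j = c • j + d • (i * j) := by
      rw [h2, add_mul, smul_mul_assoc, ← Algebra.smul_def]
    rw [← this, mul_assoc (y + i * y * i), hj, mul_neg_one, neg_neg]
  -- The signs come from `j² = -1`: multiplying `(y + i y i) j = c + d i` by `j` on the right gives
  -- `-(y + i y i) = c j + d i j`.
  refine ⟨⟨a / 2, b / 2, -c / 2, -d / 2⟩, ?_⟩
  have h4 : y = (1 / 2 : ℝ) • ((y - i * y * i) + (y + i * y * i)) := by
    match_scalars <;> norm_num
  rw [h4, h1, h3, Algebra.algebraMap_eq_smul_one]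
  show q.lift _ = _
  simp only [QuaternionAlgebra.Basis.lift, Algebra.algebraMap_eq_smul_one, q]
  match_scalars <;> ring

end Frobenius

/-- The map `ℂ → D` sending the imaginary unit to `j` is injective because `ℂ` is a field, so only
surjectivity is assumed. The form `j * j + 1 = 0` avoids negation and so applies to the semiring of
intertwining maps. -/
theorem nonempty_algEquiv_complex {D : Type*} [Semiring D] [Algebra ℝ D] [Nontrivial D] {j : D}
    (hj : j * j + 1 = 0) (h : ∀ d : D, ∃ c : ℂ, algebraMap ℝ D c.re + c.im • j = d) :
    Nonempty (D ≃ₐ[ℝ] ℂ) := by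
  let : Ring D := Algebra.semiringToRing ℝ
  let φ : ℂ →ₐ[ℝ] D := Complex.liftAux j (eq_neg_of_add_eq_zero_left hj)
  exact ⟨(AlgEquiv.ofBijective φ ⟨(φ : ℂ →+* D).injective, h⟩).symm⟩

theorem RealDivisionType.Holds.congr {E F : Type*} [Semiring E] [Algebra ℝ E] [Semiring F]
    [Algebra ℝ F] (e : E ≃ₐ[ℝ] F) {t : RealDivisionType} (h : t.Holds E) : t.Holds F := by
  cases t <;> exact h.map e.symm.trans

/-- The real dimension of a real division algebra. -/
def RealDivisionType.dim : RealDivisionType → ℕ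
  | .R => 1
  | .C => 2
  | .Q => 4

theorem RealDivisionType.Holds.finrank_eq {E : Type*} [Semiring E] [Algebra ℝ E]
    {t : RealDivisionType} (h : t.Holds E) : Module.finrank ℝ E = t.dim := by
  cases t
  · exact h.some.toLinearEquiv.finrank_eq.trans (Module.finrank_self ℝ)
  · exact h.some.toLinearEquiv.finrank_eq.trans Complex.finrank_real_complex
  · exact h.some.toLinearEquiv.finrank_eq.trans Quaternion.finrank_eq_four

/-- The real dimensions 1, 2, 4 tell the three algebras apart. -/
theorem RealDivisionType.Holds.unique {E : Type*} [Semiring E] [Algebra ℝ E]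
    {s t : RealDivisionType} (hs : s.Holds E) (ht : t.Holds E) : s = t := by
  have := hs.finrank_eq.symm.trans ht.finrank_eq
  cases s <;> cases t <;> simp_all [RealDivisionType.dim]

/-! ### Characters and conjugate representations -/

namespace Representation

theorem isIrreducible_iff {k K V : Type*} [Field k] [Monoid K] [AddCommGroup V] [Module k V]
    (ρ : Representation k K V) :
    ρ.IsIrreducible ↔ Nontrivial V ∧
      ∀ U : Submodule k V, (∀ g, ∀ v ∈ U, ρ g v ∈ U) → U = ⊥ ∨ U = ⊤ := by
  constructor
  · intro h
    refine ⟨?_, fun U hU => ?_⟩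
    · by_contra hV
      rw [not_nontrivial_iff_subsingleton] at hV
      obtain ⟨A, B, hAB⟩ := h.toNontrivial
      exact hAB (Subrepresentation.toSubmodule_injective (Subsingleton.elim _ _))
    · let A : Subrepresentation ρ := ⟨U, fun g v hv => hU g v hv⟩
      exact (h.eq_bot_or_eq_top A).imp (congrArg Subrepresentation.toSubmodule)
        (congrArg Subrepresentation.toSubmodule)
  · rintro ⟨hV, h⟩
    refine { exists_pair_ne := ⟨⊥, ⊤, fun h0 => ?_⟩, eq_bot_or_eq_top := fun A => ?_ }
    · exact bot_ne_top (congrArg Subrepresentation.toSubmodule h0 : (⊥ : Submodule k V) = ⊤)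
    · exact (h A.toSubmodule fun g v hv => A.apply_mem_toSubmodule g hv).imp
        (fun h => Subrepresentation.toSubmodule_injective h)
        (fun h => Subrepresentation.toSubmodule_injective h)

/-- In finite dimension, there is a minimal nonzero submodule with a given property. -/
theorem exists_minimal_submodule {k V : Type*} [Field k] [AddCommGroup V] [Module k V]
    [FiniteDimensional k V] [Nontrivial V] (P : Submodule k V → Prop) (hP : P ⊤) :
    ∃ U : Submodule k V, P U ∧ U ≠ ⊥ ∧
      ∀ U' : Submodule k U, P (U'.map U.subtype) → U' = ⊥ ∨ U' = ⊤ := by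
  obtain ⟨U, ⟨hU, hU0⟩, hmin⟩ := WellFounded.has_min
    (wellFounded_lt (α := Submodule k V)) {U | P U ∧ U ≠ ⊥} ⟨⊤, hP, top_ne_bot⟩
  have hinj := Submodule.map_injective_of_injective U.subtype_injective
  refine ⟨U, hU, hU0, fun U' h => ?_⟩
  by_contra! hne
  refine hmin (U'.map U.subtype) ⟨h, fun h0 => hne.1 (hinj (h0.trans (Submodule.map_bot _).symm))⟩
    (lt_of_le_of_ne (Submodule.map_subtype_le U U') fun h0 => hne.2 (hinj ?_))
  rw [h0, Submodule.map_subtype_top]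

/-- The vector space `S` with complex conjugate scalar multiplication. -/
def ConjSpace (S : Type*) : Type _ := S

instance (S : Type*) [AddCommGroup S] : AddCommGroup (ConjSpace S) := inferInstanceAs (AddCommGroup S)

instance (S : Type*) [AddCommGroup S] [Module ℂ S] : Module ℂ (ConjSpace S) :=
  Module.compHom S (starRingEnd ℂ)

variable {K S : Type*} [Group K] [AddCommGroup S] [Module ℂ S] (ρ : Representation ℂ K S)

/-- The antilinear identity map from `S` to its conjugate. -/
def ConjSpace.mk : S →ₛₗ[starRingEnd ℂ] ConjSpace S where
  toFun s := s
  map_add' _ _ := rfl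
  map_smul' c s := show c • s = conj (conj c) • s by simp

/-- The conjugate representation, twisted by an automorphism of the group. -/
def conjTwist (τ : K ≃* K) : Representation ℂ K (ConjSpace S) where
  toFun g :=
    { toFun := fun s => ρ (τ g) s
      map_add' := fun s t => map_add (ρ (τ g)) s t
      map_smul' := fun c s => (ρ (τ g)).map_smul (conj c) s }
  map_one' := by
    ext s
    exact congrArg (fun f : S →ₗ[ℂ] S => f s) (by simp : ρ (τ 1) = 1)
  map_mul' g h := by
    ext s
    exact congrArg (fun f : S →ₗ[ℂ] S => f s) (by simp : ρ (τ (g * h)) = ρ (τ g) * ρ (τ h))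

theorem conjTwist_mk (τ : K ≃* K) (g : K) (s : S) :
    ρ.conjTwist τ g (ConjSpace.mk s) = ConjSpace.mk (ρ (τ g) s) := rfl

/-- A basis of `S` regarded as a basis of the conjugate space. -/
noncomputable def ConjSpace.basis {ι : Type*} [Fintype ι] (b : Module.Basis ι ℂ S) :
    Module.Basis ι ℂ (ConjSpace S) :=
  Module.Basis.ofEquivFun
    { toFun := fun s i => conj (b.equivFun s i)
      invFun := fun v => b.equivFun.symm fun i => conj (v i)
      map_add' := fun s t => by
        ext i
        exact (congrArg (fun z => conj (z i)) (map_add b.equivFun s t)).trans (map_add _ _ _)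
      map_smul' := fun c s => by
        ext i
        refine (congrArg (fun z => conj (z i)) (b.equivFun.map_smul (conj c) s)).trans ?_
        simp
      left_inv := fun s => by
        simp only [Complex.conj_conj]
        exact b.equivFun.symm_apply_apply s
      right_inv := fun v => by
        ext i
        exact (congrArg (fun z : ι → ℂ => conj (z i)) (b.equivFun.apply_symm_apply
          fun i => conj (v i))).trans (Complex.conj_conj (v i)) }

theorem ConjSpace.basis_repr_mk {ι : Type*} [Fintype ι] (b : Module.Basis ι ℂ S) (s : S) (i : ι) :
    (ConjSpace.basis b).repr (ConjSpace.mk s) i = conj (b.repr s i) := by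
  rw [← Module.Basis.equivFun_apply, ConjSpace.basis, Module.Basis.equivFun_ofEquivFun]
  rfl

theorem ConjSpace.basis_apply {ι : Type*} [Fintype ι] (b : Module.Basis ι ℂ S) (i : ι) :
    ConjSpace.basis b i = ConjSpace.mk (b i) := by
  classical
  refine (ConjSpace.basis b).repr.injective (Finsupp.ext fun j => ?_)
  rw [ConjSpace.basis_repr_mk, Module.Basis.repr_self, Module.Basis.repr_self,
    Finsupp.single_apply]
  split_ifs <;> simp

instance [FiniteDimensional ℂ S] : FiniteDimensional ℂ (ConjSpace S) :=
  Module.Basis.finiteDimensional_of_finite (ConjSpace.basis (Module.finBasis ℂ S))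

theorem character_conjTwist [FiniteDimensional ℂ S] (τ : K ≃* K) (g : K) :
    (ρ.conjTwist τ).character g = conj (ρ.character (τ g)) := by
  let b := Module.finBasis ℂ S
  rw [character, character, LinearMap.trace_eq_matrix_trace ℂ b,
    LinearMap.trace_eq_matrix_trace ℂ (ConjSpace.basis b), Matrix.trace, Matrix.trace, map_sum]
  refine Finset.sum_congr rfl fun i _ => ?_
  rw [Matrix.diag_apply, Matrix.diag_apply, LinearMap.toMatrix_apply, LinearMap.toMatrix_apply,
    ConjSpace.basis_apply, conjTwist_mk, ConjSpace.basis_repr_mk]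

theorem isIrreducible_conjTwist (τ : K ≃* K) (h : ρ.IsIrreducible) :
    (ρ.conjTwist τ).IsIrreducible := by
  rw [isIrreducible_iff] at h ⊢
  refine ⟨h.1, fun U hU => ?_⟩
  let U' : Submodule ℂ S :=
    { carrier := {s | ConjSpace.mk s ∈ U}
      add_mem' := fun {a b} ha hb => U.add_mem ha hb
      zero_mem' := U.zero_mem
      smul_mem' := fun c s hs => by
        show ConjSpace.mk (c • s) ∈ U
        rw [LinearMap.map_smulₛₗ]
        exact U.smul_mem _ hs }
  refine (h.2 U' fun g v hv => ?_).imp (fun h0 => ?_) (fun h0 => ?_)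
  · have : ConjSpace.mk (ρ (τ (τ.symm g)) v) ∈ U := hU (τ.symm g) _ hv
    rwa [τ.apply_symm_apply] at this
  · refine (Submodule.eq_bot_iff _).2 fun v hv => ?_
    have h1 : (v : S) ∈ U' := hv
    rw [h0] at h1
    exact h1
  · refine Submodule.eq_top_iff'.2 fun v => ?_
    have h1 : (v : S) ∈ U' := by rw [h0]; trivial
    exact h1

open scoped ComplexOrder in
-- The averaged form `P = ∑ A(h)ᴴ A(h)` is positive definite, because its term at `h = 1` is the
-- identity, and it is `G`-invariant. So `A(g)ᴴ` is similar to `A(g⁻¹)` through `P`, and the traces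
-- agree.
theorem conj_character [Finite K] [FiniteDimensional ℂ S] (g : K) :
    conj (ρ.character g) = ρ.character g⁻¹ := by
  have := Fintype.ofFinite K
  let b := Module.finBasis ℂ S
  let A : K → Matrix _ _ ℂ := fun g => LinearMap.toMatrix b b (ρ g)
  have hA : ∀ g h, A (g * h) = A g * A h := fun g h => by
    simp only [A, map_mul, Module.End.mul_eq_comp, LinearMap.toMatrix_comp b b b]
  have hA1 : A 1 = 1 := by simp [A]
  have hch : ∀ g, ρ.character g = (A g).trace := fun g => LinearMap.trace_eq_matrix_trace ℂ b _
  let P := ∑ h, (A h).conjTranspose * A h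
  have hP : P.PosDef := by
    classical
    have h1 : P = (1 : Matrix _ _ ℂ) + ∑ h ∈ Finset.univ.erase (1 : K),
        (A h).conjTranspose * A h := by
      simp only [P]
      rw [← Finset.add_sum_erase _ _ (Finset.mem_univ (1 : K)), hA1]
      simp
    rw [h1]
    exact Matrix.PosDef.one.add_posSemidef
      (Matrix.posSemidef_sum _ fun h _ => Matrix.posSemidef_conjTranspose_mul_self _)
  have hPu : IsUnit P.det := (Matrix.isUnit_iff_isUnit_det _).1 hP.isUnit
  have hinv : (A g).conjTranspose * P = P * A g⁻¹ := by
    have h2 : (A g).conjTranspose * P * A g = P := by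
      simp only [P, Finset.mul_sum, Finset.sum_mul]
      refine Fintype.sum_equiv (Equiv.mulRight g) _ _ fun h => ?_
      simp [hA, Matrix.mul_assoc]
    calc (A g).conjTranspose * P = (A g).conjTranspose * P * (A g * A g⁻¹) := by
          rw [← hA, mul_inv_cancel, hA1, Matrix.mul_one]
      _ = P * A g⁻¹ := by rw [← Matrix.mul_assoc, h2]
  rw [hch, hch, starRingEnd_apply, ← Matrix.trace_conjTranspose]
  calc (A g).conjTranspose.trace = ((A g).conjTranspose * P * P⁻¹).trace := by
        rw [Matrix.mul_nonsing_inv_cancel_right _ _ hPu]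
    _ = (A g⁻¹).trace := by
        rw [hinv, Matrix.trace_mul_comm, ← Matrix.mul_assoc, Matrix.nonsing_inv_mul _ hPu,
          Matrix.one_mul]

/-- For equal characters, orthonormality would give the inner product 0 if the representations were
not isomorphic, but it is 1. -/
theorem nonempty_equiv_iff_character_eq {S' : Type*} [AddCommGroup S'] [Module ℂ S'] [Finite K]
    [FiniteDimensional ℂ S] [FiniteDimensional ℂ S'] (ρ' : Representation ℂ K S')
    (h : ρ.IsIrreducible) (h' : ρ'.IsIrreducible) :
    Nonempty (Equiv ρ ρ') ↔ ρ.character = ρ'.character := by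
  have := Fintype.ofFinite K
  have : Invertible (Nat.card K : ℂ) :=
    invertibleOfNonzero (Nat.cast_ne_zero.2 Nat.card_pos.ne')
  refine ⟨fun ⟨e⟩ => char_iso e, fun heq => ?_⟩
  by_contra hne
  have h1 := char_orthonormal ρ' ρ
  have h2 := char_orthonormal ρ' ρ'
  rw [if_neg hne, heq] at h1
  rw [if_pos ⟨Equiv.refl ρ'⟩, h1] at h2
  exact zero_ne_one h2

/-- Schur's lemma. -/
theorem exists_eq_smul_of_intertwining [FiniteDimensional ℂ S] (h : ρ.IsIrreducible)
    (f : S →ₗ[ℂ] S) (hf : ∀ g s, f (ρ g s) = ρ g (f s)) : ∃ c : ℂ, ∀ s, f s = c • s := by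
  let F : IntertwiningMap ρ ρ := ⟨f, fun g => LinearMap.ext (hf g)⟩
  obtain ⟨c, hc⟩ := (IsIrreducible.algebraMap_intertwiningMap_bijective_of_isAlgClosed (ρ := ρ)).2 F
  exact ⟨c, fun s => (congrArg (fun F : IntertwiningMap ρ ρ => F s) hc).symm⟩

/-- An antilinear endomorphism of `S` that is equivariant up to the automorphism `τ`. -/
def IsTwisted (τ : K ≃* K) (θ : S →ₛₗ[starRingEnd ℂ] S) : Prop :=
  ∀ g s, θ (ρ g s) = ρ (τ g) (θ s)

/-- Such a `θ` is the same thing as a linear intertwining map from `ρ` to its twisted conjugate.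
Both are irreducible, so a nonzero map is an isomorphism, and isomorphism is detected by characters.
-/
theorem exists_isTwisted_iff [Finite K] [FiniteDimensional ℂ S] (h : ρ.IsIrreducible)
    (τ : K ≃* K) :
    (∃ θ, ρ.IsTwisted τ θ ∧ θ ≠ 0) ↔ ∀ g, ρ.character (τ g)⁻¹ = ρ.character g := by
  have h' := ρ.isIrreducible_conjTwist τ h
  have key := nonempty_equiv_iff_character_eq ρ (ρ.conjTwist τ) h h'
  have h1 : ρ.character = (ρ.conjTwist τ).character ↔
      ∀ g, ρ.character (τ g)⁻¹ = ρ.character g := by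
    simp only [funext_iff, character_conjTwist, conj_character, eq_comm]
  rw [← h1, ← key]
  constructor
  · rintro ⟨θ, hθ, hθ0⟩
    let f : IntertwiningMap ρ (ρ.conjTwist τ) :=
      { toFun := fun s => ConjSpace.mk (θ s)
        map_add' := fun s t => by rw [map_add, map_add]
        map_smul' := fun c s => by simp
        isIntertwining' := fun g => by
          ext s
          exact hθ g s }
    rcases IsIrreducible.bijective_or_eq_zero f with hf | hf
    · exact ⟨f.ofBijective hf⟩
    · refine absurd ?_ hθ0
      ext s
      exact congrArg (fun f : IntertwiningMap ρ (ρ.conjTwist τ) => f s) hf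
  · rintro ⟨e⟩
    have := ((isIrreducible_iff ρ).1 h).1
    refine ⟨{ toFun := fun s => (e s : S), map_add' := fun s t => map_add e s t,
              map_smul' := fun c s => map_smul e c s },
      fun g s => IntertwiningMap.isIntertwining _ _ e.toIntertwiningMap g s, fun h0 => ?_⟩
    obtain ⟨s, hs⟩ := exists_ne (0 : S)
    refine hs (e.toLinearEquiv.injective ?_)
    rw [map_zero]
    exact congrArg (fun f : S →ₛₗ[starRingEnd ℂ] S => f s) h0

end Representation

/-! ### Irreducible characters form a basis of the class functions -/

/-- The set of irreducible complex characters of a group. -/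
def irreducibleCharacters (K : Type u) [Group K] : Set (K → ℂ) :=
  {χ | ∃ (S : Type u) (_ : AddCommGroup S) (_ : Module ℂ S) (_ : FiniteDimensional ℂ S)
    (ρ : Representation ℂ K S), ρ.IsIrreducible ∧ ρ.character = χ}

namespace irreducibleCharacters

variable {K : Type u} [Group K]

theorem apply_eq_of_isConj {χ : K → ℂ} (hχ : χ ∈ irreducibleCharacters K) {g h : K}
    (hgh : IsConj g h) : χ g = χ h := by
  obtain ⟨S, _, _, _, ρ, -, rfl⟩ := hχ
  obtain ⟨c, rfl⟩ := isConj_iff.1 hgh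
  exact (ρ.char_conj g c).symm

/-- An irreducible character as a function on conjugacy classes. -/
def toClassFunction (χ : irreducibleCharacters K) : ConjClasses K → ℂ :=
  Quotient.lift χ.1 fun _ _ h => apply_eq_of_isConj χ.2 h

theorem toClassFunction_mk (χ : irreducibleCharacters K) (g : K) :
    toClassFunction χ (ConjClasses.mk g) = χ.1 g := rfl

theorem sum_mul_inv_eq [Fintype K] (χ ψ : irreducibleCharacters K) [Decidable (χ = ψ)] :
    (Nat.card K : ℂ)⁻¹ * ∑ g, χ.1 g * ψ.1 g⁻¹ = if χ = ψ then 1 else 0 := by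
  classical
  obtain ⟨S, _, _, _, ρ, hρ, hχ⟩ := χ.2
  obtain ⟨S', _, _, _, ρ', hρ', hψ⟩ := ψ.2
  have : Invertible (Nat.card K : ℂ) :=
    invertibleOfNonzero (Nat.cast_ne_zero.2 Nat.card_pos.ne')
  rw [← hχ, ← hψ]
  refine (ρ.char_orthonormal ρ').trans (if_congr ?_ rfl rfl)
  rw [Representation.nonempty_equiv_iff_character_eq _ _ hρ' hρ, hχ, hψ, Subtype.ext_iff, eq_comm]

theorem linearIndependent_toClassFunction [Finite K] :
    LinearIndependent ℂ (toClassFunction (K := K)) := by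
  classical
  have := Fintype.ofFinite K
  rw [linearIndependent_iff']
  intro s c hc ψ hψ
  have h1 : ∀ g, ∑ χ ∈ s, c χ * χ.1 g = 0 := fun g => by
    simpa [toClassFunction_mk] using congrFun hc (ConjClasses.mk g)
  have h2 : ∑ χ ∈ s, c χ * ((Nat.card K : ℂ)⁻¹ * ∑ g, χ.1 g * ψ.1 g⁻¹) = 0 := by
    calc _ = (Nat.card K : ℂ)⁻¹ * ∑ g, (∑ χ ∈ s, c χ * χ.1 g) * ψ.1 g⁻¹ := by
          simp only [Finset.mul_sum, Finset.sum_mul]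
          rw [Finset.sum_comm]
          refine Finset.sum_congr rfl fun _ _ => Finset.sum_congr rfl fun _ _ => by ring
      _ = 0 := by simp [h1]
  simp only [sum_mul_inv_eq, mul_ite, mul_one, mul_zero, Finset.sum_ite_eq', if_pos hψ] at h2
  exact h2

/-- A central element of the group algebra whose coefficients are orthogonal to all irreducible
characters vanishes. -/
theorem eq_zero_of_sum_mul_eq_zero [Fintype K] (a : K → ℂ) (ha : ∀ g h, a (h * g * h⁻¹) = a g)
    (h0 : ∀ χ ∈ irreducibleCharacters K, ∑ g, a g * χ g = 0) : a = 0 := by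
  classical
  have : NeZero (Nat.card K : ℂ) := ⟨Nat.cast_ne_zero.2 Nat.card_pos.ne'⟩
  let z : ℂ[K] := ∑ g, MonoidAlgebra.single g (a g)
  have hcomm : ∀ (M : Type u) [AddCommGroup M] [Module ℂ[K] M] (g : K) (m : M),
      z • MonoidAlgebra.single g (1 : ℂ) • m = MonoidAlgebra.single g (1 : ℂ) • z • m := by
    intro M _ _ g m
    rw [← mul_smul, ← mul_smul]
    congr 1
    simp only [z, Finset.sum_mul, Finset.mul_sum, MonoidAlgebra.single_mul_single, mul_one, one_mul]
    refine Fintype.sum_equiv (MulAut.conj g⁻¹).toEquiv _ _ fun h => ?_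
    simp only [MulEquiv.toEquiv_eq_coe, EquivLike.coe_coe, MulAut.conj_apply, ha]
    congr 1
    group
  -- the central element acts by zero on simple modules
  have hsimple : ∀ N : Submodule ℂ[K] ℂ[K], IsSimpleModule ℂ[K] N → ∀ n ∈ N, z • n = 0 := by
    intro N hN n hn
    let ρ : Representation ℂ K N :=
      { toFun := fun g => Module.toModuleEnd ℂ (S := ℂ[K]) N (MonoidAlgebra.of ℂ K g)
        map_one' := by rw [map_one, map_one]
        map_mul' := fun g h => by rw [map_mul, map_mul] }
    have hρapply : ∀ g (n : N), ρ g n = MonoidAlgebra.single g (1 : ℂ) • n := fun g n => rfl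
    have hρ : ρ.IsIrreducible := by
      rw [Representation.isIrreducible_iff]
      refine ⟨IsSimpleModule.nontrivial ℂ[K] N, fun U hU => ?_⟩
      let U' : Submodule ℂ[K] N := MonoidAlgebra.submoduleOfSMulMem U hU
      have hU' : ∀ n, n ∈ U' ↔ n ∈ U := fun n => Iff.rfl
      refine (eq_bot_or_eq_top U').imp (fun h => ?_) (fun h => ?_)
      · ext n; rw [← hU', h]; simp
      · ext n; rw [← hU', h]; simp
    have := ((Representation.isIrreducible_iff ρ).1 hρ).1
    -- By Schur's lemma `T` is a scalar `c`. Its trace is `c · dim N`, but also `∑ a(g) χ(g) = 0`,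
    -- so `c = 0`.
    let T : N →ₗ[ℂ] N := ∑ g, a g • ρ g
    have hT : ∀ n : N, T n = z • n := fun n => by
      simp only [T, z, LinearMap.sum_apply, LinearMap.smul_apply, hρapply, Finset.sum_smul]
      refine Finset.sum_congr rfl fun g _ => ?_
      rw [← smul_assoc, MonoidAlgebra.smul_single, smul_eq_mul, mul_one]
    obtain ⟨c, hc⟩ := Representation.exists_eq_smul_of_intertwining ρ hρ T fun g n => by
      rw [hT, hT, hρapply, hρapply]
      exact hcomm N g n
    have htr : LinearMap.trace ℂ N T = 0 := by
      simp only [T, map_sum, map_smul, smul_eq_mul]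
      exact h0 _ ⟨N, _, _, inferInstance, ρ, hρ, rfl⟩
    have hTc : T = c • LinearMap.id := LinearMap.ext hc
    rw [hTc, map_smul, LinearMap.trace_id, smul_eq_mul, mul_eq_zero, Nat.cast_eq_zero] at htr
    have hc0 : c = 0 := htr.resolve_right Module.finrank_pos.ne'
    have := hc ⟨n, hn⟩
    rw [hT, hc0, zero_smul] at this
    exact congrArg Subtype.val this
  have hz : ∀ m : ℂ[K], z • m = 0 := by
    intro m
    -- By Maschke's theorem the regular module is the sum of its simple submodules, so `z`
    -- annihilates it; applied to 1 this gives `z = 0`.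
    have hm : m ∈ sSup {N : Submodule ℂ[K] ℂ[K] | IsSimpleModule ℂ[K] N} := by
      rw [IsSemisimpleModule.sSup_simples_eq_top]; trivial
    rw [sSup_eq_iSup'] at hm
    refine Submodule.iSup_induction _ (motive := fun m => z • m = 0) hm
      (fun N n hn => hsimple N.1 N.2 n hn) (smul_zero z) fun m n hm hn => ?_
    rw [smul_add, hm, hn, add_zero]
  have hz1 := hz 1
  rw [smul_eq_mul, mul_one] at hz1
  funext g
  have := congrArg (fun f : ℂ[K] => f.coeff g) hz1
  simpa [z, Finsupp.single_apply, MonoidAlgebra.coeff_sum] using this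

/-- A functional vanishing on all irreducible characters is represented as `φ ↦ ∑ a(g) φ(g)` with
`a` a class function; `eq_zero_of_sum_mul_eq_zero` then forces `a = 0`. -/
theorem span_range_toClassFunction [Finite K] :
    Submodule.span ℂ (Set.range (toClassFunction (K := K))) = ⊤ := by
  classical
  have := Fintype.ofFinite K
  by_contra hne
  obtain ⟨f, hf0, hf⟩ := Submodule.exists_le_ker_of_lt_top _ (lt_top_iff_ne_top.2 hne)
  let n : ConjClasses K → ℂ := fun C => ((Finset.univ.filter fun g => ConjClasses.mk g = C).card : ℂ)
  have hn : ∀ C, n C ≠ 0 := fun C => by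
    obtain ⟨g, rfl⟩ := ConjClasses.mk_surjective C
    exact Nat.cast_ne_zero.2 (Finset.card_ne_zero.2 ⟨g, by simp⟩)
  -- Dividing by the class size compensates for summing over group elements instead of classes.
  let a : ConjClasses K → ℂ := fun C => (n C)⁻¹ * f (Pi.single C 1)
  have key : ∀ φ : ConjClasses K → ℂ,
      ∑ g, a (ConjClasses.mk g) * φ (ConjClasses.mk g) = f φ := by
    intro φ
    rw [← Finset.sum_fiberwise_of_maps_to (t := Finset.univ) (g := ConjClasses.mk)
      (fun _ _ => Finset.mem_univ _)]
    conv_rhs => rw [← Finset.univ_sum_single φ, map_sum]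
    refine Finset.sum_congr rfl fun C _ => ?_
    rw [Finset.sum_congr rfl (g := fun _ => a C * φ C) fun g hg => by
      rw [(Finset.mem_filter.1 hg).2]]
    rw [Finset.sum_const, nsmul_eq_mul]
    have : (Pi.single C (φ C) : ConjClasses K → ℂ) = φ C • Pi.single C 1 := by
      rw [← Pi.single_smul, smul_eq_mul, mul_one]
    rw [this, map_smul, smul_eq_mul]
    simp only [a]
    change n C * _ = _
    field_simp [hn C]
  have ha : (fun g => a (ConjClasses.mk g)) = 0 := by
    refine eq_zero_of_sum_mul_eq_zero _ (fun g h => ?_) fun χ hχ => ?_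
    · exact congrArg a (ConjClasses.mk_eq_mk_iff_isConj.2 (isConj_iff.2 ⟨h, rfl⟩).symm)
    · have h1 := key (toClassFunction ⟨χ, hχ⟩)
      have h2 : f (toClassFunction ⟨χ, hχ⟩) = 0 := hf (Submodule.subset_span ⟨_, rfl⟩)
      rw [h2] at h1
      exact h1
  refine hf0 (LinearMap.ext fun φ => ?_)
  rw [← key φ]
  exact Finset.sum_eq_zero fun g _ => by rw [congrFun ha g]; simp

/-- The basis of the space of class functions given by irreducible characters. -/
noncomputable def basis (K : Type u) [Group K] [Finite K] :
    Module.Basis (irreducibleCharacters K) ℂ (ConjClasses K → ℂ) :=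
  Module.Basis.mk linearIndependent_toClassFunction span_range_toClassFunction.ge

theorem basis_apply [Finite K] (χ : irreducibleCharacters K) :
    basis K χ = toClassFunction χ := by
  simp [basis]

instance [Finite K] : Finite (irreducibleCharacters K) :=
  Module.Finite.finite_basis (basis K)

end irreducibleCharacters

/-! ### Brauer's permutation lemma -/

theorem Module.Basis.trace_eq_ncard_fixedPoints {ι X : Type*} [Finite ι] [AddCommGroup X] [Module ℂ X]
    (b : Module.Basis ι ℂ X) (T : X →ₗ[ℂ] X) (σ : Equiv.Perm ι) (h : ∀ i, T (b i) = b (σ i)) :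
    LinearMap.trace ℂ X T = ((Function.fixedPoints σ).ncard : ℂ) := by
  classical
  have := Fintype.ofFinite ι
  rw [LinearMap.trace_eq_matrix_trace ℂ b, Matrix.trace]
  simp only [Matrix.diag_apply, LinearMap.toMatrix_apply, h, Module.Basis.repr_self,
    Finsupp.single_apply]
  rw [Finset.sum_boole, ← Set.ncard_coe_finset]
  congr 2
  ext i
  simp [Function.mem_fixedPoints, Function.IsFixedPt]

/-- Brauer's permutation lemma. -/
theorem ncard_irreducibleCharacters_fixed_eq {K : Type u} [Group K] [Finite K]
    (σ : Equiv.Perm (ConjClasses K)) (τ : Equiv.Perm (irreducibleCharacters K))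
    (h : ∀ χ C, irreducibleCharacters.toClassFunction (τ χ) C =
      irreducibleCharacters.toClassFunction χ (σ C)) :
    (Function.fixedPoints τ).ncard = (Function.fixedPoints σ).ncard := by
  classical
  have := Fintype.ofFinite (ConjClasses K)
  -- Precomposition with `σ` permutes the irreducible characters by `τ` and the indicator functions
  -- of classes by `σ⁻¹`. Its trace is the number of fixed points in either description.
  let T : (ConjClasses K → ℂ) →ₗ[ℂ] (ConjClasses K → ℂ) := LinearMap.funLeft ℂ ℂ σ
  have h1 := (irreducibleCharacters.basis K).trace_eq_ncard_fixedPoints T τ fun χ => by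
    rw [irreducibleCharacters.basis_apply, irreducibleCharacters.basis_apply]
    funext C
    exact (h χ C).symm
  have h2 := (Pi.basisFun ℂ (ConjClasses K)).trace_eq_ncard_fixedPoints T σ.symm fun C => by
    funext D
    simp [T, LinearMap.funLeft, Pi.single_apply, Equiv.eq_symm_apply]
  have h3 : Function.fixedPoints σ.symm = Function.fixedPoints σ := by
    ext C
    simp only [Function.mem_fixedPoints, Function.IsFixedPt]
    rw [Equiv.symm_apply_eq, eq_comm]
  rw [h1, h3] at h2
  exact_mod_cast h2

/-! ### Retractions and sections -/

namespace Representation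

section Maschke

variable {k K V W : Type*} [Field k] [Group K] [Finite K] [NeZero (Nat.card K : k)]
  [AddCommGroup V] [Module k V] [AddCommGroup W] [Module k W]
  {ρ : Representation k K V} {σ : Representation k K W}

theorem exists_retraction (f : IntertwiningMap ρ σ) (hf : Function.Injective f) :
    ∃ p : IntertwiningMap σ ρ, ∀ v, p (f v) = v := by
  obtain ⟨p, hp⟩ := IsSemisimpleModule.extension_property
    (IntertwiningMap.equivLinearMapAsModule ρ σ f) hf LinearMap.id
  exact ⟨(IntertwiningMap.equivLinearMapAsModule σ ρ).symm p, fun v => LinearMap.congr_fun hp v⟩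

theorem exists_section (f : IntertwiningMap ρ σ) (hf : Function.Surjective f) :
    ∃ q : IntertwiningMap σ ρ, ∀ w, f (q w) = w := by
  obtain ⟨q, hq⟩ := IsSemisimpleModule.lifting_property
    (IntertwiningMap.equivLinearMapAsModule ρ σ f) hf LinearMap.id
  exact ⟨(IntertwiningMap.equivLinearMapAsModule σ ρ).symm q, fun v => LinearMap.congr_fun hq v⟩

end Maschke

end Representation

/-! ### Simple Real representations -/

namespace RealRepresentation

variable {Ghat : Type*} [Group Ghat] {G : Subgroup Ghat} {V : Type*} [AddCommGroup V] [Module ℂ V]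
  {V' : Type*} [AddCommGroup V'] [Module ℂ V'] {S : Type*} [AddCommGroup S] [Module ℂ S]

/-- A linear map between Real representations is equivariant for the large group. -/
def IsHom (κ : RealRepresentation G V) (κ' : RealRepresentation G V') (F : V →ₗ[ℂ] V') : Prop :=
  ∀ g v, F (κ.act g v) = κ'.act g (F v)

theorem act_act_inv (κ : RealRepresentation G V) (g : Ghat) (v : V) :
    κ.act g (κ.act g⁻¹ v) = v := by
  rw [← Module.End.mul_apply, ← map_mul, mul_inv_cancel, map_one, Module.End.one_apply]

theorem act_mul (κ : RealRepresentation G V) (g h : Ghat) (v : V) :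
    κ.act (g * h) v = κ.act g (κ.act h v) := by
  rw [map_mul, Module.End.mul_apply]

variable {κ : RealRepresentation G V} {κ' : RealRepresentation G V'}

theorem IsSimple.injective_or_eq_zero (hκ : κ.IsSimple) {F : V →ₗ[ℂ] V'} (hF : IsHom κ κ' F) :
    Function.Injective F ∨ F = 0 := by
  refine (hκ.2 (LinearMap.ker F) fun g v hv => ?_).imp LinearMap.ker_eq_bot.1 LinearMap.ker_eq_top.1
  rw [LinearMap.mem_ker, hF, LinearMap.mem_ker.1 hv, map_zero]

theorem IsSimple.surjective_or_eq_zero (hκ' : κ'.IsSimple) {F : V →ₗ[ℂ] V'} (hF : IsHom κ κ' F) :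
    Function.Surjective F ∨ F = 0 := by
  refine (hκ'.2 (LinearMap.range F) fun g v hv => ?_).symm.imp LinearMap.range_eq_top.1
    LinearMap.range_eq_bot.1
  obtain ⟨w, rfl⟩ := hv
  exact ⟨κ.act g w, hF g w⟩

/-- The sum of `T` and its conjugate by an element outside `G`. -/
def average (κ : RealRepresentation G V) (κ' : RealRepresentation G V') {x : Ghat} (hx : x ∉ G)
    (T : V →ₗ[ℂ] V') : V →ₗ[ℂ] V' where
  toFun v := T v + κ'.act x⁻¹ (T (κ.act x v))
  map_add' v w := by simp only [map_add]; abel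
  map_smul' c v := by
    have hx' : x⁻¹ ∉ G := fun h => hx (inv_mem_iff.1 h)
    rw [κ.act_smul_of_notMem x hx, map_smul, map_smul, κ'.act_smul_of_notMem _ hx',
      Complex.conj_conj, RingHom.id_apply, smul_add]

theorem average_apply {x : Ghat} (hx : x ∉ G) (T : V →ₗ[ℂ] V') (v : V) :
    average κ κ' hx T v = T v + κ'.act x⁻¹ (T (κ.act x v)) := rfl

/-- Acting by an element of `G` respects each of the summands `T` and `x⁻¹ T x`; acting by an
element outside `G` exchanges them. -/
theorem isHom_average (hG : G.index = 2) {x : Ghat} (hx : x ∉ G) {T : V →ₗ[ℂ] V'}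
    (hT : ∀ g ∈ G, ∀ v, T (κ.act g v) = κ'.act g (T v)) : IsHom κ κ' (average κ κ' hx T) := by
  have hx' : x⁻¹ ∉ G := fun h => hx (inv_mem_iff.1 h)
  intro g v
  rw [average_apply, average_apply, map_add]
  by_cases hg : g ∈ G
  · have h1 : x * g * x⁻¹ ∈ G := by simp [Subgroup.mul_mem_iff_of_index_two hG, hx, hg]
    rw [hT g hg, ← act_mul, show x * g = (x * g * x⁻¹) * x by group, act_mul, hT _ h1, ← act_mul,
      ← act_mul]
    congr 3; group
  · have h1 : x * g ∈ G := by simp [Subgroup.mul_mem_iff_of_index_two hG, hx, hg]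
    have h2 : g * x⁻¹ ∈ G := by simp [Subgroup.mul_mem_iff_of_index_two hG, hx, hg]
    rw [← act_mul κ x, hT _ h1, ← act_mul κ', inv_mul_cancel_left, add_comm]
    congr 1
    rw [show g = (g * x⁻¹) * x by group, act_mul, hT _ h2, inv_mul_cancel_right, act_mul]

/-- Two simple Real representations with a common nonzero `ℂ G`-map are isomorphic. -/
theorem exists_equiv_of_ne_zero (hG : G.index = 2) {x : Ghat} (hx : x ∉ G) (hκ : κ.IsSimple)
    (hκ' : κ'.IsSimple) {T : V →ₗ[ℂ] V'}
    (hT : ∀ g ∈ G, ∀ v, T (κ.act g v) = κ'.act g (T v)) (hT0 : T ≠ 0) :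
    ∃ e : V ≃ₗ[ℂ] V', ∀ g v, e (κ.act g v) = κ'.act g (e v) := by
  have hx' : x⁻¹ ∉ G := fun h => hx (inv_mem_iff.1 h)
  suffices h : ∃ F, IsHom κ κ' F ∧ F ≠ 0 by
    obtain ⟨F, hF, hF0⟩ := h
    exact ⟨LinearEquiv.ofBijective F ⟨(hκ.injective_or_eq_zero hF).resolve_right hF0,
      (hκ'.surjective_or_eq_zero hF).resolve_right hF0⟩, hF⟩
  by_contra! h
  -- The averages of `T` and `iT` are `T + x⁻¹ T x` and `i (T - x⁻¹ T x)`, the sign coming from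
  -- antilinearity of `x⁻¹`. If both vanish, so does `T`.
  have h1 := h _ (isHom_average hG hx hT)
  have h2 := h _ (isHom_average (T := Complex.I • T) hG hx fun g hg v => by
    rw [LinearMap.smul_apply, hT g hg, LinearMap.smul_apply, κ'.act_smul_of_mem g hg])
  apply hT0
  ext v
  have h1v := LinearMap.congr_fun h1 v
  have h2v := LinearMap.congr_fun h2 v
  rw [average_apply, LinearMap.zero_apply] at h1v h2v
  rw [LinearMap.smul_apply, LinearMap.smul_apply, κ'.act_smul_of_notMem _ hx', Complex.conj_I,
    neg_smul, ← sub_eq_add_neg, sub_eq_zero] at h2v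
  have h3 := smul_right_injective _ Complex.I_ne_zero h2v
  rw [← h3, ← two_smul ℂ] at h1v
  exact (smul_eq_zero.1 h1v).resolve_left two_ne_zero

theorem exists_equiv_of_intertwining [Finite Ghat] (hG : G.index = 2) {x : Ghat} (hx : x ∉ G)
    (hκ : κ.IsSimple) (hκ' : κ'.IsSimple) {ρ : Representation ℂ G S} (hρ : ρ.IsIrreducible)
    (f : Representation.IntertwiningMap ρ κ.restrictComplex) (hf : f ≠ 0)
    (f' : Representation.IntertwiningMap ρ κ'.restrictComplex) (hf' : f' ≠ 0) :
    ∃ e : V ≃ₗ[ℂ] V', ∀ g v, e (κ.act g v) = κ'.act g (e v) := by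
  have : NeZero (Nat.card G : ℂ) := ⟨Nat.cast_ne_zero.2 Nat.card_pos.ne'⟩
  obtain ⟨p, hp⟩ := Representation.exists_retraction f
    ((Representation.IsIrreducible.injective_or_eq_zero f).resolve_right hf)
  refine exists_equiv_of_ne_zero (T := (f'.comp p).toLinearMap) hG hx hκ hκ'
    (fun g hg v => (f'.comp p).isIntertwining _ _ ⟨g, hg⟩ v) fun h0 => hf' ?_
  ext s
  have := LinearMap.congr_fun h0 (f s)
  simpa [hp] using this

/-- Isomorphic Real representations have isomorphic endomorphism algebras. -/
theorem nonempty_endAlgebra_equiv (e : V ≃ₗ[ℂ] V') (he : ∀ g v, e (κ.act g v) = κ'.act g (e v)) :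
    Nonempty (κ.endAlgebra ≃ₐ[ℝ] κ'.endAlgebra) := by
  have he' : ∀ g v, e.symm (κ'.act g v) = κ.act g (e.symm v) := fun g v => by
    rw [LinearEquiv.symm_apply_eq, he, e.apply_symm_apply]
  let E := (e.restrictScalars ℝ).conjAlgEquiv ℝ
  have h : ∀ d, d ∈ κ.endAlgebra ↔ E d ∈ κ'.endAlgebra := by
    intro d
    constructor
    · rintro ⟨h1, h2⟩
      exact ⟨fun c v => by simp [E, h1], fun g v => by simp [E, h2, he, he']⟩
    · rintro ⟨h1, h2⟩
      refine ⟨fun c v => e.injective ?_, fun g v => e.injective ?_⟩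
      · simpa [E] using h1 c (e v)
      · simpa [E, he, he'] using h2 g (e v)
  have hmap : κ.endAlgebra.map (E : Module.End ℝ V →ₐ[ℝ] Module.End ℝ V') = κ'.endAlgebra := by
    ext d
    refine ⟨?_, fun hd => ⟨E.symm d, (h _).2 (by simpa using hd), by simp⟩⟩
    rintro ⟨d, hd, rfl⟩
    exact (h d).1 hd
  exact ⟨(E.subalgebraMap κ.endAlgebra).trans (Subalgebra.equivOfEq _ _ hmap)⟩

/-- An element of the endomorphism algebra as a complex linear map. -/
def endLinearMap (d : κ.endAlgebra) : V →ₗ[ℂ] V where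
  toFun := d.1
  map_add' := map_add d.1
  map_smul' := d.2.1

/-- An equivariant complex linear map as an element of the endomorphism algebra. -/
def IsHom.toEndAlgebra {F : V →ₗ[ℂ] V} (hF : IsHom κ κ F) : κ.endAlgebra :=
  ⟨F.restrictScalars ℝ, fun c v => F.map_smul c v, hF⟩

theorem IsSimple.eq_zero_of_apply_eq_zero (hκ : κ.IsSimple) (d : κ.endAlgebra) {v : V} (hv : v ≠ 0)
    (h : d.1 v = 0) : d = 0 := by
  rcases hκ.injective_or_eq_zero (F := endLinearMap d) (κ' := κ) d.2.2 with hd | hd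
  · exact absurd (hd (h.trans (map_zero (endLinearMap d)).symm)) hv
  · exact Subtype.ext (LinearMap.ext fun v => LinearMap.congr_fun hd v)

theorem IsSimple.isDomain_endAlgebra (hκ : κ.IsSimple) : IsDomain κ.endAlgebra := by
  have := hκ.1
  have : NoZeroDivisors κ.endAlgebra := by
    refine ⟨fun {a b} hab => ?_⟩
    by_contra! h
    obtain ⟨v, hv⟩ : ∃ v, b.1 v ≠ 0 := by
      by_contra! h0
      exact h.2 (Subtype.ext (LinearMap.ext h0))
    exact h.1 (hκ.eq_zero_of_apply_eq_zero a hv (LinearMap.congr_fun (congrArg Subtype.val hab) v))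
  have : Nontrivial κ.endAlgebra := by
    obtain ⟨v, hv⟩ := exists_ne (0 : V)
    exact ⟨0, 1, fun h => hv (LinearMap.congr_fun (congrArg Subtype.val h) v).symm⟩
  exact NoZeroDivisors.to_isDomain _

theorem IsSimple.exists_realDivisionType [FiniteDimensional ℂ V] (hκ : κ.IsSimple) :
    ∃ t : RealDivisionType, t.Holds κ.endAlgebra := by
  have := hκ.isDomain_endAlgebra
  exact exists_realDivisionType_holds

end RealRepresentation

/-! ### Endomorphisms of simple Real representations -/

namespace RealRepresentation

variable {Ghat : Type*} [Group Ghat] {G : Subgroup Ghat} {V : Type*} [AddCommGroup V] [Module ℂ V]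
  {S : Type*} [AddCommGroup S] [Module ℂ S] {κ : RealRepresentation G V}
  {ρ : Representation ℂ G S}

theorem coe_conjOnIndexTwo (hG : G.index = 2) (x : Ghat) (g : G) :
    (conjOnIndexTwo hG x g : Ghat) = x * g * x⁻¹ := rfl

theorem act_intertwining (f : Representation.IntertwiningMap ρ κ.restrictComplex) {g : Ghat}
    (hg : g ∈ G) (s : S) : κ.act g (f s) = f (ρ ⟨g, hg⟩ s) :=
  (f.isIntertwining _ _ ⟨g, hg⟩ s).symm

theorem intertwining_act (p : Representation.IntertwiningMap κ.restrictComplex ρ) {g : Ghat}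
    (hg : g ∈ G) (v : V) : p (κ.act g v) = ρ ⟨g, hg⟩ (p v) :=
  p.isIntertwining _ _ ⟨g, hg⟩ v

/-- The antilinear map on `S` induced by an element outside `G`. -/
def twistedComp (f : Representation.IntertwiningMap ρ κ.restrictComplex)
    (p : Representation.IntertwiningMap κ.restrictComplex ρ) {x : Ghat} (hx : x ∉ G) :
    S →ₛₗ[starRingEnd ℂ] S where
  toFun s := p (κ.act x (f s))
  map_add' s t := by simp only [map_add]
  map_smul' c s := by rw [map_smul, κ.act_smul_of_notMem x hx, map_smul]

theorem isTwisted_twistedComp (hG : G.index = 2) {x : Ghat} (hx : x ∉ G)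
    (f : Representation.IntertwiningMap ρ κ.restrictComplex)
    (p : Representation.IntertwiningMap κ.restrictComplex ρ) :
    ρ.IsTwisted (conjOnIndexTwo hG x) (twistedComp f p hx) := by
  intro g s
  show p (κ.act x (f (ρ g s))) = ρ _ (p (κ.act x (f s)))
  have h1 := (conjOnIndexTwo hG x g).2
  rw [coe_conjOnIndexTwo] at h1
  rw [← act_intertwining f g.2, ← act_mul, show x * (g : Ghat) = (x * g * x⁻¹) * x by group,
    act_mul, intertwining_act p h1]
  rfl

variable [Finite Ghat]

/-- With `p` a retraction of `f`, every map `p x f'` is twisted antilinear, hence zero. The average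
of `z f p` therefore acts on `f(S)` as the scalar `z`. Conversely an endomorphism is determined by
its value at one vector `f s₀`, and Schur's lemma makes that value a complex multiple of `f s₀`. -/
theorem nonempty_endAlgebra_equiv_complex [FiniteDimensional ℂ S] (hG : G.index = 2) {x : Ghat} (hx : x ∉ G)
    (hκ : κ.IsSimple) (hρ : ρ.IsIrreducible)
    (f : Representation.IntertwiningMap ρ κ.restrictComplex) (hf : f ≠ 0)
    (hθ : ∀ θ, ρ.IsTwisted (conjOnIndexTwo hG x) θ → θ = 0) :
    Nonempty (κ.endAlgebra ≃ₐ[ℝ] ℂ) := by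
  have : NeZero (Nat.card G : ℂ) := ⟨Nat.cast_ne_zero.2 Nat.card_pos.ne'⟩
  have hfinj := (Representation.IsIrreducible.injective_or_eq_zero f).resolve_right hf
  obtain ⟨p, hp⟩ := Representation.exists_retraction f hfinj
  have hvan : ∀ (f' : Representation.IntertwiningMap ρ κ.restrictComplex) s,
      p (κ.act x (f' s)) = 0 := fun f' s =>
    LinearMap.congr_fun (hθ _ (isTwisted_twistedComp hG hx f' p)) s
  have := ((Representation.isIrreducible_iff ρ).1 hρ).1
  obtain ⟨s₀, hs₀⟩ := exists_ne (0 : S)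
  have hfs₀ : f s₀ ≠ 0 := fun h => hs₀ (hfinj (h.trans (map_zero f).symm))
  have ext : ∀ d e : κ.endAlgebra, d.1 (f s₀) = e.1 (f s₀) → d = e := fun d e h => by
    rw [← sub_eq_zero]
    refine hκ.eq_zero_of_apply_eq_zero _ hfs₀ ?_
    show d.1 (f s₀) - e.1 (f s₀) = 0
    rw [h, sub_self]
  have hhom : ∀ z : ℂ, IsHom κ κ (average κ κ hx (z • (f.comp p).toLinearMap)) := fun z =>
    isHom_average hG hx fun g hg v => by
      rw [LinearMap.smul_apply, LinearMap.smul_apply, κ.act_smul_of_mem g hg]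
      exact congrArg (z • ·) ((f.comp p).isIntertwining _ _ ⟨g, hg⟩ v)
  let I : ℂ → κ.endAlgebra := fun z => (hhom z).toEndAlgebra
  have hI : ∀ z v, (I z).1 v = z • f (p v) + κ.act x⁻¹ (z • f (p (κ.act x v))) := fun z v => rfl
  have hIf : ∀ z s, (I z).1 (f s) = z • f s := fun z s => by
    rw [hI, hp, hvan f, map_zero, smul_zero, map_zero, add_zero]
  have hI1 : I 1 = 1 := ext _ _ (by rw [hIf, one_smul]; rfl)
  have hscalar : ∀ d : κ.endAlgebra, ∃ z : ℂ, d.1 (f s₀) = z • f s₀ := by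
    intro d
    let f' : Representation.IntertwiningMap ρ κ.restrictComplex :=
      ⟨endLinearMap d ∘ₗ f.toLinearMap, fun g => LinearMap.ext fun s => by
        show d.1 (f (ρ g s)) = κ.act g (d.1 (f s))
        rw [← d.2.2, act_intertwining f g.2]⟩
    have hf' : ∀ s, f' s = d.1 (f s) := fun s => rfl
    obtain ⟨z, hz⟩ := Representation.exists_eq_smul_of_intertwining ρ hρ (p.comp f').toLinearMap
      fun g s => (p.comp f').isIntertwining _ _ g s
    have hz' : ∀ s, p (f' s) = z • s := hz
    refine ⟨z, ?_⟩
    -- Since `I 1` is the identity, its formula at `f' s₀` reduces to `f (p (f' s₀)) = f' s₀`, so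
    -- `d` maps `f s₀` into `f(S)`.
    have h1 : (I 1).1 (f' s₀) = f' s₀ := by rw [hI1]; rfl
    rw [hI, hz', hvan f', map_zero, smul_zero, map_zero, add_zero, one_smul, map_smul] at h1
    rw [← hf', ← h1]
  have hII : I Complex.I * I Complex.I + 1 = 0 := ext _ _ (by
    show (I Complex.I).1 ((I Complex.I).1 (f s₀)) + f s₀ = 0
    rw [hIf, ← map_smul, hIf, map_smul, smul_smul, Complex.I_mul_I, neg_one_smul, neg_add_cancel])
  have := hκ.isDomain_endAlgebra
  refine nonempty_algEquiv_complex hII fun d => ?_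
  obtain ⟨z, hz⟩ := hscalar d
  refine ⟨z, ext _ _ ?_⟩
  rw [hz]
  show algebraMap ℝ (Module.End ℝ V) z.re (f s₀) + z.im • (I Complex.I).1 (f s₀) = z • f s₀
  rw [hIf, Module.algebraMap_end_apply, ← Complex.coe_smul, ← Complex.coe_smul, smul_smul,
    ← add_smul, Complex.re_add_im]

/-- If the algebra were `ℂ`, it would be commutative and contain `j` with `j² = -1`. After
adjustment `j` is `i` on `f(S)`, hence `-i` on `x⁻¹ f(S)`. The map `x⁻¹ f θ` then averages to an
endomorphism carrying `i`-eigenvectors of `j` to `-i`-eigenvectors, which can commute with `j` only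
if `θ = 0`. -/
theorem isEmpty_endAlgebra_equiv_complex (hG : G.index = 2) {x : Ghat} (hx : x ∉ G)
    (hρ : ρ.IsIrreducible)
    (f : Representation.IntertwiningMap ρ κ.restrictComplex) (hf : f ≠ 0)
    {θ : S →ₛₗ[starRingEnd ℂ] S} (hθ : ρ.IsTwisted (conjOnIndexTwo hG x) θ) (hθ0 : θ ≠ 0) :
    IsEmpty (κ.endAlgebra ≃ₐ[ℝ] ℂ) := by
  have hx' : x⁻¹ ∉ G := fun h => hx (inv_mem_iff.1 h)
  have : NeZero (Nat.card G : ℂ) := ⟨Nat.cast_ne_zero.2 Nat.card_pos.ne'⟩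
  refine ⟨fun φ => ?_⟩
  have hcomm : ∀ a b : κ.endAlgebra, a * b = b * a := fun a b =>
    φ.injective (by rw [map_mul, map_mul, mul_comm])
  suffices h : ∀ (j : κ.endAlgebra) (f : Representation.IntertwiningMap ρ κ.restrictComplex),
      j * j = -1 → f ≠ 0 → (∀ s, j.1 (f s) = Complex.I • f s) → False by
    obtain ⟨j, hj⟩ : ∃ j : κ.endAlgebra, j * j = -1 :=
      ⟨φ.symm Complex.I, φ.injective (by simp)⟩
    have hjj : ∀ v, j.1 (j.1 v) = -v := fun v => LinearMap.congr_fun (congrArg Subtype.val hj) v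
    let fj : Representation.IntertwiningMap ρ κ.restrictComplex :=
      ⟨endLinearMap j ∘ₗ f.toLinearMap, fun g => LinearMap.ext fun s => by
        show j.1 (f (ρ g s)) = κ.act g (j.1 (f s))
        rw [← j.2.2, act_intertwining f g.2]⟩
    have hfj : ∀ s, fj s = j.1 (f s) := fun s => rfl
    -- `f - i j f` takes values in the `i`-eigenspace of `j`. If it vanishes, `-j` acts as `i` on
    -- `f(S)` instead.
    by_cases h0 : f - Complex.I • fj = 0
    · refine h (-j) f ((neg_mul_neg j j).trans hj) hf fun s => ?_
      have h1 : f s - Complex.I • fj s = 0 :=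
        congrArg (fun F : Representation.IntertwiningMap ρ κ.restrictComplex => F s) h0
      rw [hfj, sub_eq_zero] at h1
      show -(j.1 (f s)) = _
      conv_rhs => rw [h1, smul_smul, Complex.I_mul_I, neg_one_smul]
    · refine h j _ hj h0 fun s => ?_
      show j.1 (f s - Complex.I • fj s) = Complex.I • (f s - Complex.I • fj s)
      rw [hfj, map_sub, j.2.1, hjj, smul_sub, smul_smul, Complex.I_mul_I, neg_one_smul, smul_neg]
      abel
  clear hf f
  intro j f hj hf hjf
  have hfinj := (Representation.IsIrreducible.injective_or_eq_zero f).resolve_right hf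
  obtain ⟨p, hp⟩ := Representation.exists_retraction f hfinj
  -- the image of `f` under the semilinear operator defined by `x` and `θ`
  let q : S →ₗ[ℂ] V :=
    { toFun := fun s => κ.act x⁻¹ (f (θ s))
      map_add' := fun s t => by simp only [map_add]
      map_smul' := fun c s => by
        rw [LinearMap.map_smulₛₗ, map_smul, κ.act_smul_of_notMem _ hx', Complex.conj_conj,
          RingHom.id_apply] }
  have hq : ∀ s, q s = κ.act x⁻¹ (f (θ s)) := fun s => rfl
  have hqG : ∀ g (hg : g ∈ G) s, q (ρ ⟨g, hg⟩ s) = κ.act g (q s) := by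
    intro g hg s
    have h1 := (conjOnIndexTwo hG x ⟨g, hg⟩).2
    rw [coe_conjOnIndexTwo] at h1
    have h2 : f (θ (ρ ⟨g, hg⟩ s)) = κ.act (x * g * x⁻¹) (f (θ s)) := by
      rw [hθ, act_intertwining f h1]; rfl
    rw [hq, hq, h2, ← act_mul, ← act_mul]
    congr 2; group
  have hjq : ∀ s, j.1 (q s) = -(Complex.I • q s) := fun s => by
    rw [hq, j.2.2, hjf, κ.act_smul_of_notMem _ hx', Complex.conj_I, neg_smul]
  -- the projection onto the eigenspace of `j`
  let P : V →ₗ[ℂ] S := (1 / 2 : ℂ) • p.toLinearMap ∘ₗ (LinearMap.id - Complex.I • endLinearMap j)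
  have hP : ∀ v, P v = (1 / 2 : ℂ) • p (v - Complex.I • j.1 v) := fun v => rfl
  have hPf : ∀ s, P (f s) = s := fun s => by
    rw [hP, hjf, smul_smul, Complex.I_mul_I, neg_one_smul, sub_neg_eq_add, ← two_smul ℂ, map_smul,
      hp, smul_smul]
    norm_num
  have hPx : ∀ s, P (κ.act x (f s)) = 0 := fun s => by
    rw [hP, j.2.2, hjf, κ.act_smul_of_notMem _ hx, smul_smul, Complex.conj_I, mul_neg,
      Complex.I_mul_I, neg_neg, one_smul, sub_self, map_zero, smul_zero]
  have hPG : ∀ g (hg : g ∈ G) v, P (κ.act g v) = ρ ⟨g, hg⟩ (P v) := fun g hg v => by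
    rw [hP, hP, j.2.2, ← κ.act_smul_of_mem g hg, ← map_sub, intertwining_act p hg, map_smul]
  have hT := isHom_average (κ := κ) (κ' := κ) (T := q ∘ₗ P) hG hx fun g hg v => by
    rw [LinearMap.comp_apply, LinearMap.comp_apply, hPG g hg, hqG]
  let T := hT.toEndAlgebra
  have hTf : ∀ s, T.1 (f s) = q s := fun s => by
    show q (P (f s)) + κ.act x⁻¹ (q (P (κ.act x (f s)))) = q s
    rw [hPf, hPx, map_zero, map_zero, add_zero]
  apply hθ0
  ext s
  have h1 : T.1 (j.1 (f s)) = j.1 (T.1 (f s)) :=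
    LinearMap.congr_fun (congrArg Subtype.val (hcomm T j)) (f s)
  rw [hjf, T.2.1, hTf, hjq, ← add_eq_zero_iff_eq_neg, ← two_smul ℂ, smul_smul] at h1
  have h2 := (smul_eq_zero.1 h1).resolve_left (mul_ne_zero two_ne_zero Complex.I_ne_zero)
  rw [hq] at h2
  have h3 := congrArg (κ.act x) h2
  rw [act_act_inv, map_zero] at h3
  exact hfinj (h3.trans (map_zero f).symm)

end RealRepresentation

/-! ### Induced Real representations -/

namespace RealRepresentation

section Induced

variable {Ghat : Type*} [Group Ghat] {G : Subgroup Ghat} {S : Type*} [AddCommGroup S] [Module ℂ S]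

open Classical in
/-- The identity for elements of `G`, complex conjugation for the others. -/
noncomputable def scalarTwist (G : Subgroup Ghat) (y : Ghat) : ℂ →+* ℂ :=
  if y ∈ G then RingHom.id ℂ else starRingEnd ℂ

theorem scalarTwist_of_mem {y : Ghat} (hy : y ∈ G) (c : ℂ) : scalarTwist G y c = c := by
  simp [scalarTwist, hy]

theorem scalarTwist_of_notMem {y : Ghat} (hy : y ∉ G) (c : ℂ) : scalarTwist G y c = conj c := by
  simp [scalarTwist, hy]

theorem scalarTwist_mul (hG : G.index = 2) (y g : Ghat) (c : ℂ) :
    scalarTwist G (y * g) c = scalarTwist G y (scalarTwist G g c) := by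
  by_cases hy : y ∈ G <;> by_cases hg : g ∈ G <;>
    simp [scalarTwist, Subgroup.mul_mem_iff_of_index_two hG, hy, hg]

theorem scalarTwist_ofReal (y : Ghat) (r : ℝ) : scalarTwist G y r = r := by
  by_cases hy : y ∈ G <;> simp [scalarTwist, hy]

/-- The additive group of `G`-equivariant functions from the large group to `S`. -/
def equivariantFunctions (ρ : Representation ℂ G S) : AddSubgroup (Ghat → S) where
  carrier := {F | ∀ (h : G) (y : Ghat), F (h * y) = ρ h (F y)}
  add_mem' {a b} ha hb h y := by simp [ha h y, hb h y]
  zero_mem' h y := by simp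
  neg_mem' {a} ha h y := by simp [ha h y]

/-- The Real representation induced from `S`. -/
def Induced (ρ : Representation ℂ G S) : Type _ := equivariantFunctions ρ

variable (ρ : Representation ℂ G S)

instance : AddCommGroup (Induced ρ) := inferInstanceAs (AddCommGroup (equivariantFunctions ρ))

variable {ρ} in
/-- The value of an element of the induced representation. -/
def Induced.eval (F : Induced ρ) (y : Ghat) : S := F.1 y

variable {ρ} in
theorem Induced.ext {F F' : Induced ρ} (h : ∀ y, F.eval y = F'.eval y) : F = F' :=
  Subtype.ext (funext h)

variable {ρ} in
theorem Induced.eval_mul (F : Induced ρ) (h : G) (y : Ghat) : F.eval (h * y) = ρ h (F.eval y) :=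
  F.2 h y

variable {ρ} in
theorem Induced.eval_add (F F' : Induced ρ) (y : Ghat) : (F + F').eval y = F.eval y + F'.eval y :=
  rfl

variable [hG : Fact (G.index = 2)]

/-- Conjugating the scalar at arguments outside `G` is what makes right translation by elements
outside `G` antilinear. -/
noncomputable instance : SMul ℂ (Induced ρ) where
  smul c F := ⟨fun y => scalarTwist G y c • F.eval y, fun h y => by
    beta_reduce
    rw [F.eval_mul, scalarTwist_mul hG.out, scalarTwist_of_mem h.2, map_smul]⟩

theorem Induced.eval_smul {ρ : Representation ℂ G S} (c : ℂ) (F : Induced ρ) (y : Ghat) :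
    (c • F).eval y = scalarTwist G y c • F.eval y := rfl

noncomputable instance : Module ℂ (Induced ρ) where
  one_smul F := Induced.ext fun y => by rw [Induced.eval_smul, map_one, one_smul]
  mul_smul a b F := Induced.ext fun y => by simp only [Induced.eval_smul, map_mul, mul_smul]
  smul_zero c := Induced.ext fun y => smul_zero _
  smul_add c F F' := Induced.ext fun y => smul_add _ _ _
  add_smul a b F := Induced.ext fun y => by
    simp only [Induced.eval_smul, Induced.eval_add, map_add, add_smul]
  zero_smul F := Induced.ext fun y => by rw [Induced.eval_smul, map_zero, zero_smul]; rfl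

/-- The action on the induced representation, by right translation. -/
noncomputable def induced : RealRepresentation G (Induced ρ) where
  act :=
    { toFun := fun g =>
        { toFun := fun F => ⟨fun y => F.eval (y * g), fun h y => by
            beta_reduce
            rw [mul_assoc, F.eval_mul]⟩
          map_add' := fun F F' => rfl
          map_smul' := fun r F => Induced.ext fun y => by
            show scalarTwist G (y * g) r • F.eval (y * g) = scalarTwist G y r • F.eval (y * g)
            rw [scalarTwist_ofReal, scalarTwist_ofReal] }
      map_one' := LinearMap.ext fun F => Induced.ext fun y => by
        show F.eval (y * 1) = F.eval y
        rw [mul_one]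
      map_mul' := fun g h => LinearMap.ext fun F => Induced.ext fun y => by
        show F.eval (y * (g * h)) = F.eval (y * g * h)
        rw [mul_assoc] }
  act_smul_of_mem g hg c F := Induced.ext fun y => by
    show scalarTwist G (y * g) c • F.eval (y * g) = scalarTwist G y c • F.eval (y * g)
    rw [scalarTwist_mul hG.out, scalarTwist_of_mem hg]
  act_smul_of_notMem g hg c F := Induced.ext fun y => by
    show scalarTwist G (y * g) c • F.eval (y * g) = scalarTwist G y (conj c) • F.eval (y * g)
    rw [scalarTwist_mul hG.out, scalarTwist_of_notMem hg]

/-- An equivariant function is determined by its values at 1 and `x`, one for each coset. The value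
at `x` depends antilinearly on the function, hence the conjugate space. -/
theorem finiteDimensional_induced [FiniteDimensional ℂ S] {x : Ghat} (hx : x ∉ G) :
    FiniteDimensional ℂ (Induced ρ) := by
  let ev : Induced ρ →ₗ[ℂ] S × Representation.ConjSpace S :=
    { toFun := fun F => (F.eval 1, Representation.ConjSpace.mk (F.eval x))
      map_add' := fun F F' => rfl
      map_smul' := fun c F => by
        rw [Induced.eval_smul, Induced.eval_smul, scalarTwist_of_mem G.one_mem,
          scalarTwist_of_notMem hx, LinearMap.map_smulₛₗ, Complex.conj_conj]
        rfl }
  refine FiniteDimensional.of_injective ev (LinearMap.ker_eq_bot.1 ?_)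
  refine (Submodule.eq_bot_iff _).2 fun F hF => Induced.ext fun y => ?_
  have h1 : F.eval 1 = 0 := congrArg Prod.fst (LinearMap.mem_ker.1 hF)
  have h2 : F.eval x = 0 := congrArg Prod.snd (LinearMap.mem_ker.1 hF)
  by_cases hy : y ∈ G
  · have := F.eval_mul ⟨y, hy⟩ 1
    rwa [h1, map_zero, mul_one] at this
  · have hyx : y * x⁻¹ ∈ G := by simp [Subgroup.mul_mem_iff_of_index_two hG.out, hx, hy]
    have := F.eval_mul ⟨_, hyx⟩ x
    rwa [h2, map_zero, inv_mul_cancel_right] at this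

end Induced

/-! ### Stable subspaces and existence of simple Real representations -/

variable {Ghat : Type*} [Group Ghat] {G : Subgroup Ghat} {V : Type*} [AddCommGroup V] [Module ℂ V]

/-- The restriction of a Real representation to a stable subspace. -/
def restrict (κ : RealRepresentation G V) (U : Submodule ℂ V)
    (hU : ∀ g, ∀ v ∈ U, κ.act g v ∈ U) : RealRepresentation G U where
  act :=
    { toFun := fun g =>
        { toFun := fun v => ⟨κ.act g v, hU g v v.2⟩
          map_add' := fun v w => Subtype.ext (map_add (κ.act g) (v : V) w)
          map_smul' := fun r v => Subtype.ext (map_smul (κ.act g) r (v : V)) }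
      map_one' := by ext v; simp
      map_mul' := fun g h => by ext v; simp }
  act_smul_of_mem g hg c v := Subtype.ext (κ.act_smul_of_mem g hg c v)
  act_smul_of_notMem g hg c v := Subtype.ext (κ.act_smul_of_notMem g hg c v)

/-- Every irreducible representation of `G` occurs in a simple Real representation. -/
theorem exists_isSimple {Ghat : Type u} [Group Ghat] [Finite Ghat] {G : Subgroup Ghat}
    (hG : G.index = 2) {x : Ghat} (hx : x ∉ G) {S : Type u} [AddCommGroup S] [Module ℂ S]
    [FiniteDimensional ℂ S] (ρ : Representation ℂ G S) (hρ : ρ.IsIrreducible) :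
    ∃ (V : Type u) (_ : AddCommGroup V) (_ : Module ℂ V) (_ : FiniteDimensional ℂ V)
      (κ : RealRepresentation G V), κ.IsSimple ∧
        ∃ f : Representation.IntertwiningMap ρ κ.restrictComplex, f ≠ 0 := by
  have := Fact.mk hG
  have : NeZero (Nat.card G : ℂ) := ⟨Nat.cast_ne_zero.2 Nat.card_pos.ne'⟩
  have := finiteDimensional_induced ρ hx
  have := ((Representation.isIrreducible_iff ρ).1 hρ).1
  have : Nontrivial (Induced ρ) := by
    classical
    obtain ⟨s₀, hs₀⟩ := exists_ne (0 : S)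
    -- The function supported on `G` with value `s₀` at 1 shows that the induced representation is
    -- nonzero.
    let F : Induced ρ := ⟨fun y => if hy : y ∈ G then ρ ⟨y, hy⟩ s₀ else 0, fun h y => by
      beta_reduce
      by_cases hy : y ∈ G
      · rw [dif_pos hy, dif_pos (G.mul_mem h.2 hy), ← Module.End.mul_apply, ← map_mul]
        rfl
      · rw [dif_neg hy, dif_neg fun h' => hy ((G.mul_mem_cancel_left h.2).1 h'), map_zero]⟩
    refine ⟨F, 0, fun h0 => hs₀ ?_⟩
    have h1 : F.eval 1 = 0 := congrArg (fun F => F.eval 1) h0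
    have h2 : F.eval 1 = ρ 1 s₀ := dif_pos G.one_mem
    rwa [h2, map_one] at h1
  obtain ⟨U, hU, hU0, hmin⟩ := Representation.exists_minimal_submodule
    (fun U : Submodule ℂ (Induced ρ) => ∀ g, ∀ v ∈ U, (induced ρ).act g v ∈ U) fun _ _ _ => trivial
  refine ⟨U, _, _, inferInstance, (induced ρ).restrict U hU,
    ⟨(Submodule.nontrivial_iff_ne_bot).2 hU0, fun U' hU' => hmin U' ?_⟩, ?_⟩
  · rintro g _ ⟨v, hv, rfl⟩
    exact ⟨_, hU' g v hv, rfl⟩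
  let ev : Representation.IntertwiningMap ((induced ρ).restrict U hU).restrictComplex ρ :=
    { toFun := fun F => F.1.eval 1
      map_add' := fun F F' => rfl
      map_smul' := fun c F => by
        show scalarTwist G 1 c • F.1.eval 1 = _
        rw [scalarTwist_of_mem G.one_mem, RingHom.id_apply]
      isIntertwining' := fun g => LinearMap.ext fun F => by
        show F.1.eval (1 * g) = ρ g (F.1.eval 1)
        rw [← Induced.eval_mul, one_mul, mul_one] }
  -- Translation by `y` moves the value at `y` to 1, so evaluation at 1 cannot vanish on a nonzero
  -- stable subspace. A section of it embeds `S`.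
  have hev : Function.Surjective ev := by
    refine (Representation.IsIrreducible.surjective_or_eq_zero ev).resolve_right fun h0 => hU0 ?_
    refine (Submodule.eq_bot_iff _).2 fun F hF => Induced.ext fun y => ?_
    have h1 : ev ⟨_, hU y F hF⟩ = 0 := by rw [h0]; rfl
    have h2 : F.eval (1 * y) = 0 := h1
    rwa [one_mul] at h2
  obtain ⟨q, hq⟩ := Representation.exists_section ev hev
  refine ⟨q, fun h0 => ?_⟩
  obtain ⟨s₀, hs₀⟩ := exists_ne (0 : S)
  have h1 := hq s₀
  rw [h0] at h1
  exact hs₀ (h1.symm.trans (map_zero ev))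

end RealRepresentation

/-! ### Simple real constituents of irreducible complex representations -/

namespace Representation

variable {K S W W' : Type*} [Group K] [AddCommGroup S] [Module ℂ S] [AddCommGroup W] [Module ℝ W]
  [AddCommGroup W'] [Module ℝ W'] {ρ : Representation ℂ K S} {σ : Representation ℝ K W}
  {σ' : Representation ℝ K W'}

theorem intertwining_toReal (f : IntertwiningMap σ ρ.toReal) (g : K) (w : W) :
    f (σ g w) = ρ g (f w) := f.isIntertwining _ _ g w

theorem toReal_intertwining (p : IntertwiningMap ρ.toReal σ) (g : K) (s : S) :
    p (ρ g s) = σ g (p s) := p.isIntertwining _ _ g s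

/-- Multiplication by `i` as an endomorphism of the underlying real representation. -/
def mulI (ρ : Representation ℂ K S) : IntertwiningMap ρ.toReal ρ.toReal where
  toFun s := Complex.I • s
  map_add' _ _ := smul_add _ _ _
  map_smul' _ _ := smul_comm _ _ _
  isIntertwining' g := LinearMap.ext fun s => ((ρ g).map_smul Complex.I s).symm

theorem smul_eq_re_im (c : ℂ) (s : S) : c • s = c.re • s + c.im • (Complex.I • s) := by
  rw [← Complex.coe_smul, ← Complex.coe_smul, smul_smul, ← add_smul, Complex.re_add_im]

/-- Two simple real constituents of an irreducible complex representation are isomorphic. -/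
theorem nonempty_equiv_of_intertwining [Finite K] (hρ : ρ.IsIrreducible) (hσ : σ.IsIrreducible)
    (hσ' : σ'.IsIrreducible) (f : IntertwiningMap σ ρ.toReal) (hf : f ≠ 0)
    (f' : IntertwiningMap σ' ρ.toReal) (hf' : f' ≠ 0) : Nonempty (Equiv σ σ') := by
  have : NeZero (Nat.card K : ℝ) := ⟨Nat.cast_ne_zero.2 Nat.card_pos.ne'⟩
  obtain ⟨p, hp⟩ := exists_retraction f'
    ((IsIrreducible.injective_or_eq_zero f').resolve_right hf')
  suffices h : ∃ q : IntertwiningMap σ σ', q ≠ 0 by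
    obtain ⟨q, hq⟩ := h
    exact ⟨q.ofBijective ((IsIrreducible.bijective_or_eq_zero q).resolve_right hq)⟩
  by_contra! h
  have h1 : ∀ w, p (f w) = 0 := fun w =>
    congrArg (fun q : IntertwiningMap σ σ' => q w) (h (p.comp f))
  have h2 : ∀ w, p (Complex.I • f w) = 0 := fun w =>
    congrArg (fun q : IntertwiningMap σ σ' => q w) (h (p.comp ((mulI ρ).comp f)))
  -- This is the largest complex subspace on which `p` vanishes. It contains `f(W)`, so it is
  -- nonzero, yet it cannot be all of `S` because `p` is a retraction of `f'`.
  let U : Submodule ℂ S :=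
    { carrier := {s | p s = 0 ∧ p (Complex.I • s) = 0}
      add_mem' := fun {a b} ha hb => ⟨by rw [map_add, ha.1, hb.1, add_zero],
        by rw [smul_add, map_add, ha.2, hb.2, add_zero]⟩
      zero_mem' := ⟨map_zero p, by rw [smul_zero, map_zero]⟩
      smul_mem' := fun c s hs => by
        have h3 : ∀ c : ℂ, p (c • s) = 0 := fun c => by
          rw [smul_eq_re_im, map_add, map_smul, map_smul, hs.1, hs.2, smul_zero, smul_zero,
            add_zero]
        exact ⟨h3 c, by rw [smul_smul]; exact h3 _⟩ }
  have hU := ((isIrreducible_iff ρ).1 hρ).2 U fun g s hs =>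
    ⟨by rw [toReal_intertwining, hs.1, map_zero],
      by rw [← map_smul, toReal_intertwining, hs.2, map_zero]⟩
  rcases hU with hU | hU
  · apply hf
    ext w
    have : f w ∈ U := ⟨h1 w, h2 w⟩
    rw [hU] at this
    exact this
  · have := ((isIrreducible_iff σ').1 hσ').1
    obtain ⟨w, hw⟩ := exists_ne (0 : W')
    have h3 : f' w ∈ U := by rw [hU]; trivial
    exact hw ((hp w).symm.trans h3.1)

/-- Isomorphic representations have isomorphic endomorphism algebras. -/
def Equiv.endAlgEquiv (e : Equiv σ σ') :
    IntertwiningMap σ σ ≃ₐ[ℝ] IntertwiningMap σ' σ' where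
  toFun d := (e.toIntertwiningMap.comp d).comp e.symm.toIntertwiningMap
  invFun d := (e.symm.toIntertwiningMap.comp d).comp e.toIntertwiningMap
  left_inv d := by ext w; simp
  right_inv d := by ext w; simp
  map_mul' d d' := by ext w; simp
  map_add' d d' := by ext w; simp
  commutes' r := by ext w; simp

theorem isDomain_intertwiningMap (hσ : σ.IsIrreducible) : IsDomain (IntertwiningMap σ σ) := by
  let : Ring (IntertwiningMap σ σ) := Algebra.semiringToRing ℝ
  have := ((isIrreducible_iff σ).1 hσ).1
  have : NoZeroDivisors (IntertwiningMap σ σ) := by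
    refine ⟨fun {a b} hab => or_iff_not_imp_left.2 fun ha => ?_⟩
    have ha := (IsIrreducible.injective_or_eq_zero a).resolve_right ha
    ext w
    refine ha (Eq.trans ?_ (map_zero a).symm)
    exact congrArg (fun d : IntertwiningMap σ σ => d w) hab
  have : Nontrivial (IntertwiningMap σ σ) := by
    obtain ⟨w, hw⟩ := exists_ne (0 : W)
    exact ⟨0, 1, fun h => hw (congrArg (fun d : IntertwiningMap σ σ => d w) h).symm⟩
  exact NoZeroDivisors.to_isDomain _

theorem exists_realDivisionType [FiniteDimensional ℝ W] (hσ : σ.IsIrreducible) :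
    ∃ t : RealDivisionType, t.Holds (IntertwiningMap σ σ) := by
  let : Ring (IntertwiningMap σ σ) := Algebra.semiringToRing ℝ
  have := isDomain_intertwiningMap hσ
  have : FiniteDimensional ℝ (IntertwiningMap σ σ) :=
    FiniteDimensional.of_injective
      ({ toFun := fun d => d.toLinearMap, map_add' := fun _ _ => rfl, map_smul' := fun _ _ => rfl } :
        IntertwiningMap σ σ →ₗ[ℝ] Module.End ℝ W) (IntertwiningMap.toLinearMap_injective σ σ)
  exact exists_realDivisionType_holds

theorem exists_real_constituent {S : Type u} [AddCommGroup S] [Module ℂ S] [FiniteDimensional ℂ S]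
    (ρ : Representation ℂ K S) (hρ : ρ.IsIrreducible) :
    ∃ (W : Type u) (_ : AddCommGroup W) (_ : Module ℝ W) (_ : FiniteDimensional ℝ W)
      (σ : Representation ℝ K W), σ.IsIrreducible ∧
        ∃ f : IntertwiningMap σ ρ.toReal, f ≠ 0 := by
  have := ((isIrreducible_iff ρ).1 hρ).1
  obtain ⟨U, hU, hU0, hmin⟩ := exists_minimal_submodule
    (fun U : Submodule ℝ S => ∀ g, ∀ v ∈ U, ρ.toReal g v ∈ U) fun _ _ _ => Submodule.mem_top
  let A : Subrepresentation ρ.toReal := ⟨U, hU⟩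
  refine ⟨U, _, _, inferInstance, A.toRepresentation, ?_,
    ⟨U.subtype, fun g => rfl⟩, fun h0 => hU0 ?_⟩
  · rw [isIrreducible_iff]
    refine ⟨(Submodule.nontrivial_iff_ne_bot).2 hU0, fun U' hU' => hmin U' ?_⟩
    rintro g _ ⟨v, hv, rfl⟩
    exact ⟨_, hU' g v hv, rfl⟩
  · refine (Submodule.eq_bot_iff _).2 fun s hs => ?_
    exact congrArg (fun f : IntertwiningMap A.toRepresentation ρ.toReal => f ⟨s, hs⟩) h0

/-- If there is no antilinear endomorphism, every real endomorphism is a scalar. -/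
theorem exists_eq_smul_of_real [FiniteDimensional ℂ S] (hρ : ρ.IsIrreducible)
    (hθ : ∀ θ, ρ.IsTwisted (MulEquiv.refl K) θ → θ = 0)
    (T : IntertwiningMap ρ.toReal ρ.toReal) : ∃ c : ℂ, ∀ s, T s = c • s := by
  have hII : ∀ s : S, Complex.I • Complex.I • s = -s := fun s => by
    rw [smul_smul, Complex.I_mul_I, neg_one_smul]
  -- `T + i T i` is twice the antilinear part of `T`; if it vanishes, `T` is complex linear and
  -- Schur's lemma applies.
  let θ : S →ₛₗ[starRingEnd ℂ] S :=
    { toFun := fun s => T s + Complex.I • T (Complex.I • s)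
      map_add' := fun s t => by simp only [map_add, smul_add]; abel
      map_smul' := fun c s => by
        rw [smul_comm Complex.I c s, smul_eq_re_im c s, smul_eq_re_im c (Complex.I • s), hII,
          smul_eq_re_im (conj c), Complex.conj_re, Complex.conj_im]
        simp only [map_add, map_smul, map_neg, smul_add, smul_neg, neg_smul, hII,
          smul_comm Complex.I (_ : ℝ)]
        abel }
  have h0 := hθ θ fun g s => by
    show T (ρ g s) + Complex.I • T (Complex.I • ρ g s) = ρ g (T s + Complex.I • T (Complex.I • s))
    have hT : ∀ s, T (ρ g s) = ρ g (T s) := fun s => T.isIntertwining _ _ g s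
    rw [map_add, (ρ g).map_smul, ← (ρ g).map_smul Complex.I s, hT, hT]
  have h1 : ∀ s, T (Complex.I • s) = Complex.I • T s := fun s => by
    have h2 : T s + Complex.I • T (Complex.I • s) = 0 := LinearMap.congr_fun h0 s
    rw [eq_neg_of_add_eq_zero_left h2, smul_neg, hII, neg_neg]
  exact exists_eq_smul_of_intertwining ρ hρ
    { toFun := T, map_add' := map_add T, map_smul' := fun c s => by
        rw [smul_eq_re_im, map_add, map_smul, map_smul, h1, ← smul_eq_re_im, RingHom.id_apply] }
    fun g s => intertwining_toReal T g s

/-- All real endomorphisms of `S` are now complex scalars. In particular `f p` is a scalar fixing a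
nonzero vector, so it is 1 and `W` is all of `S` regarded over `ℝ`. -/
theorem nonempty_intertwiningMap_equiv_complex [Finite K] [FiniteDimensional ℂ S]
    (hρ : ρ.IsIrreducible) (hσ : σ.IsIrreducible) (f : IntertwiningMap σ ρ.toReal) (hf : f ≠ 0)
    (hθ : ∀ θ, ρ.IsTwisted (MulEquiv.refl K) θ → θ = 0) :
    Nonempty (IntertwiningMap σ σ ≃ₐ[ℝ] ℂ) := by
  have : NeZero (Nat.card K : ℝ) := ⟨Nat.cast_ne_zero.2 Nat.card_pos.ne'⟩
  have hfinj := (IsIrreducible.injective_or_eq_zero f).resolve_right hf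
  obtain ⟨p, hp⟩ := exists_retraction f hfinj
  have := ((isIrreducible_iff σ).1 hσ).1
  have hfp : ∀ s, f (p s) = s := by
    obtain ⟨c, hc⟩ := exists_eq_smul_of_real hρ hθ (f.comp p)
    obtain ⟨w, hw⟩ := exists_ne (0 : W)
    have hfw : f w ≠ 0 := fun h => hw (hfinj (h.trans (map_zero f).symm))
    have h1 := hc (f w)
    rw [IntertwiningMap.comp_apply, hp] at h1
    have h2 : (c - 1) • f w = 0 := by rw [sub_smul, one_smul, ← h1, sub_self]
    rw [sub_eq_zero.1 ((smul_eq_zero.1 h2).resolve_right hfw)] at hc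
    exact fun s => (hc s).trans (one_smul ℂ s)
  have := isDomain_intertwiningMap hσ
  let j : IntertwiningMap σ σ := p.comp ((mulI ρ).comp f)
  have hj : ∀ w, f (j w) = Complex.I • f w := fun w => hfp _
  have hjj : j * j + 1 = 0 := by
    ext w
    refine hfinj ?_
    show f (j (j w) + w) = f 0
    rw [map_add, hj, hj, smul_smul, Complex.I_mul_I, neg_one_smul, neg_add_cancel, map_zero]
  refine nonempty_algEquiv_complex hjj fun d => ?_
  obtain ⟨c, hc⟩ := exists_eq_smul_of_real hρ hθ (f.comp (d.comp p))
  refine ⟨c, ?_⟩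
  ext w
  refine hfinj ?_
  have h1 := hc (f w)
  rw [IntertwiningMap.comp_apply, IntertwiningMap.comp_apply, hp] at h1
  show f (c.re • w + c.im • j w) = f (d w)
  rw [h1, map_add, map_smul, map_smul, hj, ← smul_eq_re_im]

/-- If the algebra were `ℂ`, a square root `j` of `-1` would make `W` complex and, after adjustment,
`f` complex linear. Its image is then a complex subrepresentation, so `f` is an isomorphism.
Transported to `W`, the map `θ` anticommutes with `j`, against commutativity unless `θ = 0`. -/
theorem isEmpty_intertwiningMap_equiv_complex (hρ : ρ.IsIrreducible) (hσ : σ.IsIrreducible)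
    (f : IntertwiningMap σ ρ.toReal) (hf : f ≠ 0)
    {θ : S →ₛₗ[starRingEnd ℂ] S} (hθ : ρ.IsTwisted (MulEquiv.refl K) θ) (hθ0 : θ ≠ 0) :
    IsEmpty (IntertwiningMap σ σ ≃ₐ[ℝ] ℂ) := by
  refine ⟨fun φ => ?_⟩
  have hcomm : ∀ a b : IntertwiningMap σ σ, a * b = b * a := fun a b =>
    φ.injective (by rw [map_mul, map_mul, mul_comm])
  have hII : ∀ s : S, Complex.I • Complex.I • s = -s := fun s => by
    rw [smul_smul, Complex.I_mul_I, neg_one_smul]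
  suffices h : ∀ (j : IntertwiningMap σ σ) (f : IntertwiningMap σ ρ.toReal),
      f ≠ 0 → (∀ w, f (j w) = Complex.I • f w) → False by
    obtain ⟨j, hj⟩ : ∃ j : IntertwiningMap σ σ, j * j + 1 = 0 :=
      ⟨φ.symm Complex.I, φ.injective (by simp)⟩
    have hjj : ∀ w, j (j w) = -w := fun w => eq_neg_of_add_eq_zero_left
      (congrArg (fun d : IntertwiningMap σ σ => d w) hj)
    -- `f - i f j` is complex linear for the structure `j`; if it vanishes, `f` is complex linear
    -- for `-j`.
    by_cases h0 : f - (mulI ρ).comp (f.comp j) = 0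
    · refine h (-j) f hf fun w => ?_
      have h1 : f w - Complex.I • f (j w) = 0 :=
        congrArg (fun F : IntertwiningMap σ ρ.toReal => F w) h0
      rw [sub_eq_zero] at h1
      show f (-(j w)) = _
      conv_rhs => rw [h1, hII]
      rw [map_neg]
    · refine h j _ h0 fun w => ?_
      show f (j w) - Complex.I • f (j (j w)) = Complex.I • (f w - Complex.I • f (j w))
      rw [hjj, map_neg, smul_sub, hII, smul_neg]
      abel
  clear hf f
  intro j f hf hjf
  have hfinj := (IsIrreducible.injective_or_eq_zero f).resolve_right hf
  have hfsurj : Function.Surjective f := by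
    let U : Submodule ℂ S :=
      { carrier := Set.range f
        add_mem' := by
          rintro _ _ ⟨a, rfl⟩ ⟨b, rfl⟩
          exact ⟨a + b, map_add f a b⟩
        zero_mem' := ⟨0, map_zero f⟩
        smul_mem' := by
          rintro c _ ⟨w, rfl⟩
          refine ⟨c.re • w + c.im • j w, ?_⟩
          rw [map_add, map_smul, map_smul, hjf, ← smul_eq_re_im] }
    have hU := ((isIrreducible_iff ρ).1 hρ).2 U (by
      rintro g _ ⟨w, rfl⟩
      exact ⟨σ g w, intertwining_toReal f g w⟩)
    rcases hU with hU | hU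
    · refine absurd ?_ hf
      ext w
      have : f w ∈ U := ⟨w, rfl⟩
      rw [hU] at this
      exact this
    · intro s
      have : s ∈ U := by rw [hU]; trivial
      exact this
  let e := f.ofBijective ⟨hfinj, hfsurj⟩
  have he : ∀ s, f (e.symm s) = s := fun s => e.apply_symm_apply s
  let Θ : IntertwiningMap ρ.toReal ρ.toReal :=
    { toFun := θ
      map_add' := map_add θ
      map_smul' := fun r s => by
        rw [← Complex.coe_smul, LinearMap.map_smulₛₗ, Complex.conj_ofReal, Complex.coe_smul]
        rfl
      isIntertwining' := fun g => LinearMap.ext fun s => hθ g s }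
  let k : IntertwiningMap σ σ := e.symm.toIntertwiningMap.comp (Θ.comp f)
  have hk : ∀ w, f (k w) = θ (f w) := fun w => he _
  apply hθ0
  ext s
  obtain ⟨w, rfl⟩ := hfsurj s
  have h1 : f (k (j w)) = f (j (k w)) :=
    congrArg f (congrArg (fun d : IntertwiningMap σ σ => d w) (hcomm k j))
  rw [hk, hjf, hjf, hk, LinearMap.map_smulₛₗ, Complex.conj_I, neg_smul, neg_eq_iff_add_eq_zero,
    ← two_smul ℂ, smul_smul] at h1
  exact (smul_eq_zero.1 h1).resolve_left (mul_ne_zero two_ne_zero Complex.I_ne_zero)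

end Representation

/-! ### The Dyson type of an irreducible character -/

theorem RealRepresentation.isIsotypic_iff_of_equiv {Ghat V V' : Type*} [Group Ghat]
    {G : Subgroup Ghat} [AddCommGroup V] [Module ℂ V] [AddCommGroup V'] [Module ℂ V']
    {κ : RealRepresentation G V} {κ' : RealRepresentation G V'} (e : V ≃ₗ[ℂ] V')
    (he : ∀ g v, e (κ.act g v) = κ'.act g (e v)) :
    IsIsotypic ℝ[G] κ.restrictReal.asModule ↔ IsIsotypic ℝ[G] κ'.restrictReal.asModule := by
  let F : Representation.IntertwiningMap κ.restrictReal κ'.restrictReal :=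
    ⟨e.toLinearMap.restrictScalars ℝ, fun g => LinearMap.ext fun v => he g v⟩
  exact (LinearEquiv.ofBijective (Representation.IntertwiningMap.equivLinearMapAsModule _ _ F)
    e.bijective).isIsotypic_iff

namespace Representation

/-- An isomorphism of complex representations is an isomorphism of the real representations. -/
def Equiv.toReal {K S S' : Type*} [Group K] [AddCommGroup S] [Module ℂ S] [AddCommGroup S']
    [Module ℂ S'] {ρ : Representation ℂ K S} {ρ' : Representation ℂ K S'} (e : Equiv ρ ρ') :
    Equiv ρ.toReal ρ'.toReal :=
  .mk (e.toLinearEquiv.restrictScalars ℝ) fun g => LinearMap.ext fun s =>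
    e.toIntertwiningMap.isIntertwining _ _ g s

theorem IntertwiningMap.comp_equiv_ne_zero {k K V W X : Type*} [Field k] [Group K] [AddCommGroup V]
    [Module k V] [AddCommGroup W] [Module k W] [AddCommGroup X] [Module k X]
    {ρ : Representation k K V} {σ : Representation k K W} {τ : Representation k K X}
    (e : Equiv ρ σ) {f : IntertwiningMap σ τ} (hf : f ≠ 0) : f.comp e.toIntertwiningMap ≠ 0 := by
  refine fun h0 => hf ?_
  ext w
  have := congrArg (fun F : IntertwiningMap ρ τ => F (e.symm w)) h0
  simpa using this

theorem IntertwiningMap.equiv_comp_ne_zero {k K V W X : Type*} [Field k] [Group K] [AddCommGroup V]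
    [Module k V] [AddCommGroup W] [Module k W] [AddCommGroup X] [Module k X]
    {ρ : Representation k K V} {σ : Representation k K W} {τ : Representation k K X}
    (e : Equiv σ τ) {f : IntertwiningMap ρ σ} (hf : f ≠ 0) : e.toIntertwiningMap.comp f ≠ 0 := by
  refine fun h0 => hf ?_
  ext v
  refine e.toLinearEquiv.injective ?_
  have := congrArg (fun F : IntertwiningMap ρ τ => F v) h0
  exact this.trans (map_zero e.toLinearEquiv).symm

end Representation

namespace HasDysonType

variable {Ghat : Type u} [Group Ghat] {G : Subgroup Ghat}

theorem mem_irreducibleCharacters {χ : G → ℂ} {t : DysonType} (h : HasDysonType G χ t) :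
    χ ∈ irreducibleCharacters G := by
  obtain ⟨S, _, _, _, ρ, V, _, _, κ, W, _, _, σ, hρ, hχ, -⟩ := h
  exact ⟨S, _, _, inferInstance, ρ, hρ, hχ⟩

variable [Finite Ghat]

/-- Frobenius's theorem supplies both letters. Each of the nine pairs of letters belongs to a type,
and the digit chooses between IV and VII for the pair `(ℂ, ℂ)`. -/
theorem exists_of_mem (hG : G.index = 2) {x : Ghat} (hx : x ∉ G) {χ : G → ℂ} (h : χ ∈ irreducibleCharacters G) :
    ∃ t, HasDysonType G χ t := by
  obtain ⟨S, _, _, _, ρ, hρ, hχ⟩ := h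
  obtain ⟨V, _, _, _, κ, hκ, f, hf⟩ := RealRepresentation.exists_isSimple hG hx ρ hρ
  obtain ⟨W, _, _, _, σ, hσ, f', hf'⟩ := Representation.exists_real_constituent ρ hρ
  obtain ⟨d, hd⟩ := hκ.exists_realDivisionType
  obtain ⟨a, ha⟩ := Representation.exists_realDivisionType hσ
  obtain ⟨t, ht, ht', ht''⟩ : ∃ t : DysonType, t.Fd = d ∧ t.Fa = a ∧ t.DigitHolds κ := by
    by_cases hi : IsIsotypic ℝ[G] κ.restrictReal.asModule
    · cases d <;> cases a
      exacts [⟨.I, rfl, rfl, trivial⟩, ⟨.V, rfl, rfl, trivial⟩, ⟨.IX, rfl, rfl, trivial⟩,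
        ⟨.III, rfl, rfl, trivial⟩, ⟨.IV, rfl, rfl, hi⟩, ⟨.X, rfl, rfl, trivial⟩,
        ⟨.II, rfl, rfl, trivial⟩, ⟨.VI, rfl, rfl, trivial⟩, ⟨.VIII, rfl, rfl, trivial⟩]
    · cases d <;> cases a
      exacts [⟨.I, rfl, rfl, trivial⟩, ⟨.V, rfl, rfl, trivial⟩, ⟨.IX, rfl, rfl, trivial⟩,
        ⟨.III, rfl, rfl, trivial⟩, ⟨.VII, rfl, rfl, hi⟩, ⟨.X, rfl, rfl, trivial⟩,
        ⟨.II, rfl, rfl, trivial⟩, ⟨.VI, rfl, rfl, trivial⟩, ⟨.VIII, rfl, rfl, trivial⟩]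
  exact ⟨t, S, _, _, inferInstance, ρ, V, _, _, κ, W, _, _, σ, hρ, hχ, hκ, ⟨f, hf⟩, hσ, ⟨f', hf'⟩,
    ht ▸ hd, ht' ▸ ha, ht''⟩

/-- `V` and `W` are determined by `χ` up to isomorphism, hence so are both letters and the digit.
Distinct types differ in a letter, except IV and VII, which differ in the digit. -/
theorem unique (hG : G.index = 2) {x : Ghat} (hx : x ∉ G)
    {χ : G → ℂ} {t t' : DysonType} (h : HasDysonType G χ t) (h' : HasDysonType G χ t') : t = t' := by
  obtain ⟨S, _, _, _, ρ, V, _, _, κ, W, _, _, σ, hρ, hχ, hκ, ⟨f, hf⟩, hσ, ⟨q, hq⟩, hd, ha, hi⟩ := h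
  obtain ⟨S', _, _, _, ρ', V', _, _, κ', W', _, _, σ', hρ', hχ', hκ', ⟨f', hf'⟩, hσ', ⟨q', hq'⟩,
    hd', ha', hi'⟩ := h'
  obtain ⟨e⟩ := (Representation.nonempty_equiv_iff_character_eq ρ ρ' hρ hρ').2 (hχ.trans hχ'.symm)
  obtain ⟨E, hE⟩ := RealRepresentation.exists_equiv_of_intertwining hG hx hκ hκ' hρ f hf _
    (Representation.IntertwiningMap.comp_equiv_ne_zero e hf')
  obtain ⟨D⟩ := RealRepresentation.nonempty_endAlgebra_equiv E hE
  obtain ⟨E'⟩ := Representation.nonempty_equiv_of_intertwining hρ hσ hσ' q hq _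
    (Representation.IntertwiningMap.equiv_comp_ne_zero e.symm.toReal hq')
  have hFd : t.Fd = t'.Fd := (hd.congr D).unique hd'
  have hFa : t.Fa = t'.Fa := (ha.congr E'.endAlgEquiv).unique ha'
  have hiso := RealRepresentation.isIsotypic_iff_of_equiv E hE
  cases t <;> cases t' <;>
    first
      | rfl
      | (simp [DysonType.Fd] at hFd; done)
      | (simp [DysonType.Fa] at hFa; done)
      | exact absurd (hiso.1 hi) hi'
      | exact absurd (hiso.2 hi') hi

/-- The dichotomy for `τ = 1`: an antilinear `G`-map on `S` exists exactly when `χ` is real-valued.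
-/
theorem Fa_eq_C_iff {χ : G → ℂ} {t : DysonType} (h : HasDysonType G χ t) :
    t.Fa = .C ↔ ¬ ∀ g, χ g⁻¹ = χ g := by
  obtain ⟨S, _, _, _, ρ, V, _, _, κ, W, _, _, σ, hρ, rfl, -, -, hσ, ⟨q, hq⟩, -, ha, -⟩ := h
  have key := ρ.exists_isTwisted_iff hρ (MulEquiv.refl G)
  simp only [MulEquiv.refl_apply] at key
  rw [← key]
  constructor
  · rintro hC ⟨θ, hθ, hθ0⟩
    rw [hC] at ha
    exact (Representation.isEmpty_intertwiningMap_equiv_complex hρ hσ q hq hθ hθ0).false ha.some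
  · intro hθ
    push Not at hθ
    exact ha.unique (t := .C)
      (Representation.nonempty_intertwiningMap_equiv_complex hρ hσ q hq hθ)

/-- The dichotomy for `τ` equal to conjugation by `x`. -/
theorem Fd_eq_C_iff (hG : G.index = 2) {x : Ghat} (hx : x ∉ G)
    {χ : G → ℂ} {t : DysonType} (h : HasDysonType G χ t) :
    t.Fd = .C ↔ ¬ ∀ g, χ (conjOnIndexTwo hG x g)⁻¹ = χ g := by
  obtain ⟨S, _, _, _, ρ, V, _, _, κ, W, _, _, σ, hρ, rfl, hκ, ⟨f, hf⟩, -, -, hd, -⟩ := h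
  rw [← ρ.exists_isTwisted_iff hρ]
  constructor
  · rintro hC ⟨θ, hθ, hθ0⟩
    rw [hC] at hd
    exact (RealRepresentation.isEmpty_endAlgebra_equiv_complex hG hx hρ f hf hθ hθ0).false hd.some
  · intro hθ
    push Not at hθ
    exact hd.unique (t := .C)
      (RealRepresentation.nonempty_endAlgebra_equiv_complex hG hx hκ hρ f hf hθ)

end HasDysonType

/-! ### Counting characters and classes -/

namespace irreducibleCharacters

variable {K : Type u} [Group K] [Finite K]

/-- This is the character of the twisted conjugate representation. -/
theorem twist_mem {χ : K → ℂ} (hχ : χ ∈ irreducibleCharacters K) (τ : K ≃* K) :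
    (fun g => χ (τ g)⁻¹) ∈ irreducibleCharacters K := by
  obtain ⟨S, _, _, _, ρ, hρ, rfl⟩ := hχ
  refine ⟨_, _, _, inferInstance, ρ.conjTwist τ, ρ.isIrreducible_conjTwist τ hρ, ?_⟩
  funext g
  rw [Representation.character_conjTwist, Representation.conj_character]

/-- The number of irreducible characters fixed by a twist is the number of fixed classes. -/
theorem ncard_twist_fixed_eq (τ : K ≃* K) :
    {χ : irreducibleCharacters K | ∀ g, χ.1 (τ g)⁻¹ = χ.1 g}.ncard =
      {C : ConjClasses K | C.invClass.map τ.toMonoidHom = C}.ncard := by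
  let P : irreducibleCharacters K → irreducibleCharacters K := fun χ => ⟨_, twist_mem χ.2 τ⟩
  have hP : Function.Injective P := fun χ ψ h => Subtype.ext <| funext fun g => by
    have := congrFun (congrArg Subtype.val h) (τ.symm g⁻¹)
    simpa [P] using this
  let Q : ConjClasses K → ConjClasses K := fun C => C.invClass.map τ.toMonoidHom
  have hQmk : ∀ g, Q (ConjClasses.mk g) = ConjClasses.mk (τ g⁻¹) := fun g => rfl
  have hQ : Function.Surjective Q := fun C => by
    obtain ⟨g, rfl⟩ := ConjClasses.mk_surjective C
    exact ⟨ConjClasses.mk (τ.symm g)⁻¹, by rw [hQmk, inv_inv, τ.apply_symm_apply]⟩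
  have h := ncard_irreducibleCharacters_fixed_eq
    (Equiv.ofBijective Q (Finite.surjective_iff_bijective.1 hQ))
    (Equiv.ofBijective P (Finite.injective_iff_bijective.1 hP)) fun χ C => by
      obtain ⟨g, rfl⟩ := ConjClasses.mk_surjective C
      rw [Equiv.ofBijective_apply, Equiv.ofBijective_apply, hQmk, toClassFunction_mk,
        toClassFunction_mk, map_inv]
  have h1 : {χ : irreducibleCharacters K | ∀ g, χ.1 (τ g)⁻¹ = χ.1 g} =
      Function.fixedPoints (Equiv.ofBijective P (Finite.injective_iff_bijective.1 hP)) := by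
    ext χ
    exact ⟨fun h => Subtype.ext (funext h), fun h => congrFun (congrArg Subtype.val h)⟩
  rw [h1, h]
  rfl

theorem natCard_eq : Nat.card (irreducibleCharacters K) = Nat.card (ConjClasses K) := by
  have := Fintype.ofFinite (ConjClasses K)
  rw [← Module.finrank_eq_nat_card_basis (basis K),
    Module.finrank_eq_nat_card_basis (Pi.basisFun ℂ (ConjClasses K))]

theorem ncard_twist_not_fixed_eq (τ : K ≃* K) :
    {χ : irreducibleCharacters K | ¬ ∀ g, χ.1 (τ g)⁻¹ = χ.1 g}.ncard =
      {C : ConjClasses K | ¬ C.invClass.map τ.toMonoidHom = C}.ncard := by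
  have h1 := Set.ncard_add_ncard_compl {χ : irreducibleCharacters K | ∀ g, χ.1 (τ g)⁻¹ = χ.1 g}
  have h2 := Set.ncard_add_ncard_compl {C : ConjClasses K | C.invClass.map τ.toMonoidHom = C}
  rw [ncard_twist_fixed_eq, natCard_eq, ← h2] at h1
  exact add_left_cancel h1

end irreducibleCharacters

theorem Set.ncard_setOf_eq_sum {X : Type*} [Fintype X] (p : X → Prop) [DecidablePred p] :
    {a | p a}.ncard = ∑ a, if p a then 1 else 0 := by
  rw [← Finset.card_filter, ← Set.ncard_coe_finset, Finset.coe_filter]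
  simp

/-! ### Orbits of the Klein four-group -/

section Orbits

variable {Ghat : Type u} [Group Ghat] {G : Subgroup Ghat} (hG : G.index = 2) (x : Ghat)

theorem classOrbit_eq (C : ConjClasses G) : classOrbit hG x C =
    {C, classAction hG x .a C, classAction hG x .b C, classAction hG x .c C} := by
  ext D
  simp only [classOrbit, Set.mem_range, Set.mem_insert_iff, Set.mem_singleton_iff]
  constructor
  · rintro ⟨k, rfl⟩
    cases k <;> simp [classAction]
  · rintro (rfl | rfl | rfl | rfl)
    exacts [⟨.one, rfl⟩, ⟨.a, rfl⟩, ⟨.b, rfl⟩, ⟨.c, rfl⟩]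

theorem classAction_a_a (C : ConjClasses G) :
    classAction hG x .a (classAction hG x .a C) = C := by
  obtain ⟨g, rfl⟩ := ConjClasses.mk_surjective C
  exact congrArg ConjClasses.mk (inv_inv g)

theorem classAction_b_a (C : ConjClasses G) :
    classAction hG x .b (classAction hG x .a C) = classAction hG x .c C := rfl

theorem classAction_a_b (C : ConjClasses G) :
    classAction hG x .a (classAction hG x .b C) = classAction hG x .c C := by
  obtain ⟨g, rfl⟩ := ConjClasses.mk_surjective C
  exact congrArg ConjClasses.mk (map_inv (conjOnIndexTwo hG x) g).symm

theorem classAction_b_b (C : ConjClasses G) :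
    classAction hG x .b (classAction hG x .b C) = C := by
  obtain ⟨g, rfl⟩ := ConjClasses.mk_surjective C
  -- Conjugating twice by `x` is conjugation by `x²`, which lies in `G`.
  refine ConjClasses.mk_eq_mk_iff_isConj.2 (isConj_iff.2
    ⟨⟨x * x, Subgroup.mul_self_mem_of_index_two hG x⟩, Subtype.ext ?_⟩).symm
  show x * x * (g : Ghat) * (x * x)⁻¹ = x * (x * g * x⁻¹) * x⁻¹
  group

/-- The orbit size is 4 divided by the order of the stabilizer, and a subgroup containing two of `a,
b, c` contains the third. So the type can be read off from which of them fix the class. -/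
theorem hasClassType_iff (C : ConjClasses G) :
    (HasClassType hG x C .one ↔ classAction hG x .a C = C ∧ classAction hG x .b C = C) ∧
    (HasClassType hG x C .twoA ↔ classAction hG x .a C = C ∧ classAction hG x .b C ≠ C) ∧
    (HasClassType hG x C .twoB ↔ classAction hG x .a C ≠ C ∧ classAction hG x .b C = C) ∧
    (HasClassType hG x C .twoC ↔ classAction hG x .a C ≠ C ∧ classAction hG x .c C = C) ∧
    (HasClassType hG x C .four ↔ classAction hG x .a C ≠ C ∧ classAction hG x .b C ≠ C ∧
      classAction hG x .c C ≠ C) := by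
  have haa := classAction_a_a hG x C
  have hbb := classAction_b_b hG x C
  have hba := classAction_b_a hG x C
  have hab := classAction_a_b hG x C
  have hbc := classAction_b_b hG x (classAction hG x .a C)
  have hac := classAction_a_a hG x (classAction hG x .b C)
  rw [hba] at hbc
  rw [hab] at hac
  have horb := classOrbit_eq hG x C
  simp only [HasClassType, horb]
  generalize classAction hG x .a = a at *
  generalize classAction hG x .b = b at *
  generalize classAction hG x .c C = c at *
  by_cases hA : a C = C
  · by_cases hB : b C = C
    · have hc : c = C := by rw [← hba, hA, hB]
      simp [hA, hB, hc]
    · have hc : c = b C := by rw [← hba, hA]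
      have : ({C, b C} : Set (ConjClasses G)).ncard = 2 := Set.ncard_pair (Ne.symm hB)
      simp [hA, hB, hc, this]
  · by_cases hB : b C = C
    · have hc : c = a C := by rw [← hab, hB]
      have : ({C, a C} : Set (ConjClasses G)).ncard = 2 := Set.ncard_pair (Ne.symm hA)
      simp [hA, hB, hc, this]
    · by_cases hc : c = C
      · have hb : b C = a C := by rw [← hbc, hc]
        simp [hA, hc, hb]
      · have h1 : a C ≠ b C := fun h => hc (by rw [← hab, ← h, haa])
        have h2 : a C ≠ c := fun h => hB (by rw [← hac, ← h, haa])
        have h3 : b C ≠ c := fun h => hA (by rw [← hbc, ← h, hbb])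
        have : ({C, a C, b C, c} : Set (ConjClasses G)).ncard = 4 := by
          rw [Set.ncard_insert_of_notMem (by simp [Ne.symm hA, Ne.symm hB, Ne.symm hc]),
            Set.ncard_insert_of_notMem (by simp [h1, h2]), Set.ncard_pair h3]
        simp [hA, hB, hc, this]

end Orbits

/-! ### Both sides as numbers of fixed or non-fixed points -/

section Counting

variable {Ghat : Type u} [Group Ghat] [Finite Ghat] {G : Subgroup Ghat}

theorem classCount_eq_ncard (hG : G.index = 2) (x : Ghat) :
    classCount hG x .one + classCount hG x .twoA = {C | classAction hG x .a C = C}.ncard ∧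
    classCount hG x .twoB + classCount hG x .twoC + classCount hG x .four =
      {C | ¬ classAction hG x .a C = C}.ncard ∧
    classCount hG x .twoA + classCount hG x .twoB + classCount hG x .four =
      {C | ¬ classAction hG x .c C = C}.ncard := by
  classical
  have := Fintype.ofFinite (ConjClasses G)
  have hab : ∀ C, classAction hG x .a C = C →
      (classAction hG x .b C = C ↔ classAction hG x .c C = C) := fun C h => by
    rw [← classAction_b_a, h]
  have hba : ∀ C, classAction hG x .b C = C →
      (classAction hG x .a C = C ↔ classAction hG x .c C = C) := fun C h => by
    rw [← classAction_a_b, h]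
  have key := hasClassType_iff hG x
  simp only [classCount, fun C => (key C).1, fun C => (key C).2.1, fun C => (key C).2.2.1,
    fun C => (key C).2.2.2.1, fun C => (key C).2.2.2.2, Set.ncard_setOf_eq_sum,
    ← Finset.sum_add_distrib]
  refine ⟨Finset.sum_congr rfl fun C _ => ?_, Finset.sum_congr rfl fun C _ => ?_,
    Finset.sum_congr rfl fun C _ => ?_⟩ <;>
  · have h1 := hab C
    have h2 := hba C
    by_cases hA : classAction hG x .a C = C <;> by_cases hB : classAction hG x .b C = C <;>
      by_cases hC : classAction hG x .c C = C <;> simp_all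

/-- Since every character has exactly one type, the sums can be compared character by character,
leaving a check of the letters `Fa` and `Fd` for each of the ten types. -/
theorem dysonCount_eq_ncard (hG : G.index = 2) {x : Ghat} (hx : x ∉ G) :
    dysonCount G .I + dysonCount G .II + dysonCount G .III + dysonCount G .VIII
      + dysonCount G .IX + dysonCount G .X =
      {χ : irreducibleCharacters G | ∀ g, χ.1 g⁻¹ = χ.1 g}.ncard ∧
    dysonCount G .IV + dysonCount G .V + dysonCount G .VI + dysonCount G .VII =
      {χ : irreducibleCharacters G | ¬ ∀ g, χ.1 g⁻¹ = χ.1 g}.ncard ∧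
    dysonCount G .III + dysonCount G .IV + dysonCount G .VII + dysonCount G .X =
      {χ : irreducibleCharacters G | ¬ ∀ g, χ.1 (conjOnIndexTwo hG x g)⁻¹ = χ.1 g}.ncard := by
  classical
  have := Fintype.ofFinite (irreducibleCharacters G)
  choose ty hty using fun χ : irreducibleCharacters G => HasDysonType.exists_of_mem hG hx χ.2
  have hcount : ∀ t, dysonCount G t = ∑ χ, if ty χ = t then 1 else 0 := fun t => by
    rw [← Set.ncard_setOf_eq_sum, dysonCount,
      ← Set.ncard_image_of_injective _ Subtype.val_injective]
    congr 1
    ext χ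
    constructor
    · exact fun h => ⟨⟨χ, h.mem_irreducibleCharacters⟩, (hty _).unique hG hx h, rfl⟩
    · rintro ⟨χ, rfl, rfl⟩
      exact hty χ
  have hreal : ∀ χ : irreducibleCharacters G, (∀ g, χ.1 g⁻¹ = χ.1 g) ↔ (ty χ).Fa ≠ .C :=
    fun χ => by rw [Ne, (hty χ).Fa_eq_C_iff, not_not]
  have hconj : ∀ χ : irreducibleCharacters G,
      (∀ g, χ.1 (conjOnIndexTwo hG x g)⁻¹ = χ.1 g) ↔ (ty χ).Fd ≠ .C :=
    fun χ => by rw [Ne, (hty χ).Fd_eq_C_iff hG hx, not_not]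
  simp only [hcount, hreal, hconj, Set.ncard_setOf_eq_sum, ← Finset.sum_add_distrib]
  refine ⟨Finset.sum_congr rfl fun χ _ => ?_, Finset.sum_congr rfl fun χ _ => ?_,
    Finset.sum_congr rfl fun χ _ => ?_⟩ <;>
  · generalize ty χ = t
    cases t <;> simp [DysonType.Fa, DysonType.Fd]

end Counting

theorem mainTheorem7 {Ghat : Type u} [Group Ghat] [Finite Ghat] (G : Subgroup Ghat)
    (hG : G.index = 2) (x : Ghat) (hx : x ∉ G) :
    (dysonCount G .I + dysonCount G .II + dysonCount G .III + dysonCount G .VIII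
          + dysonCount G .IX + dysonCount G .X
        = classCount hG x .one + classCount hG x .twoA ∧
      dysonCount G .IV + dysonCount G .V + dysonCount G .VI + dysonCount G .VII
        = classCount hG x .twoB + classCount hG x .twoC + classCount hG x .four ∧
      dysonCount G .III + dysonCount G .IV + dysonCount G .VII + dysonCount G .X
        = classCount hG x .twoA + classCount hG x .twoB + classCount hG x .four) ∧
    -- linear independence of the equations in the ten variables `N` and the five variables `C`
    LinearIndependent ℚ (![
      fun p => p.1 .I + p.1 .II + p.1 .III + p.1 .VIII + p.1 .IX + p.1 .X
        - (p.2 .one + p.2 .twoA),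
      fun p => p.1 .IV + p.1 .V + p.1 .VI + p.1 .VII - (p.2 .twoB + p.2 .twoC + p.2 .four),
      fun p => p.1 .III + p.1 .IV + p.1 .VII + p.1 .X - (p.2 .twoA + p.2 .twoB + p.2 .four)] :
      Fin 3 → (DysonType → ℚ) × (ClassType → ℚ) → ℚ) ∧
    -- linear independence of the left-hand sides in the ten variables `N`
    LinearIndependent ℚ (![
      fun N => N .I + N .II + N .III + N .VIII + N .IX + N .X,
      fun N => N .IV + N .V + N .VI + N .VII,
      fun N => N .III + N .IV + N .VII + N .X] :
      Fin 3 → (DysonType → ℚ) → ℚ) := by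
  obtain ⟨c1, c2, c3⟩ := classCount_eq_ncard hG x
  obtain ⟨d1, d2, d3⟩ := dysonCount_eq_ncard hG hx
  have hrefl : ∀ C : ConjClasses G,
      C.invClass.map (MulEquiv.refl G).toMonoidHom = classAction hG x .a C := fun C => by
    obtain ⟨g, rfl⟩ := ConjClasses.mk_surjective C
    rfl
  have e1 := irreducibleCharacters.ncard_twist_fixed_eq (MulEquiv.refl G)
  have e2 := irreducibleCharacters.ncard_twist_not_fixed_eq (MulEquiv.refl G)
  have e3 := irreducibleCharacters.ncard_twist_not_fixed_eq (conjOnIndexTwo hG x)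
  simp only [hrefl, MulEquiv.refl_apply] at e1 e2
  refine ⟨⟨by rw [c1, d1, e1], by rw [c2, d2, e2], by rw [c3, d3, e3]; rfl⟩, ?_, ?_⟩
  · rw [Fintype.linearIndependent_iff]
    intro g hg
    -- `N_I` occurs only in the first form, `N_V` only in the second, and `N_III` in the first and
    -- third. Evaluation at these three unit vectors gives a triangular system for the coefficients.
    have h1 := congrFun hg (fun | .I => 1 | _ => 0, 0)
    have h2 := congrFun hg (fun | .V => 1 | _ => 0, 0)
    have h3 := congrFun hg (fun | .III => 1 | _ => 0, 0)
    simp [Fin.sum_univ_three] at h1 h2 h3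
    intro i
    fin_cases i <;> simp_all
  · rw [Fintype.linearIndependent_iff]
    intro g hg
    have h1 := congrFun hg (fun | .I => 1 | _ => 0)
    have h2 := congrFun hg (fun | .V => 1 | _ => 0)
    have h3 := congrFun hg (fun | .III => 1 | _ => 0)
    simp [Fin.sum_univ_three] at h1 h2 h3
    intro i
    fin_cases i <;> simp_all
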